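/- Let $d\ge 2$ be an integer, let $\sigma$ be the standard surface measure on the unit sphere $\mathbb{S}^{d-1}\subset\mathbb{R}^d$, let $\omega_{d-2}=2\pi^{(d-1)/2}/\Gamma((d-1)/2)$ be the total surface measure of $\mathbb{S}^{d-2}\subset\mathbb{R}^{d-1}$ (so $\omega_0=2$), and for $f\in L^1(\mathbb{S}^{d-1},\sigma)$ put $$\widehat{f\sigma}(\xi)=\int_{\mathbb{S}^{d-1}}e^{-i\zeta\cdot\xi}f(\zeta)\,d\sigma(\zeta)\qquad(\xi\in\mathbb{R}^d).$$ Let $f_1,f_2\in L^1(\mathbb{S}^{d-1},\sigma)$ be complex-valued functions, neither of which vanishes $\sigma$-almost everywhere. Then $$\big\|\widehat{f_1\sigma}\,\widehat{f_2\sigma}\big\|_{L^2(\mathbb{R}^d)}^2\le(2\pi)^d\,2^{(2-d)/2}\,\omega_{d-2}\int_{(\mathbb{S}^{d-1})^2}\left[\frac{(1-\zeta_1\cdot\zeta_2)^{d-3}}{1+\zeta_1\cdot\zeta_2}\right]^{1/2}|f_1(\zeta_1)|^2\,|f_2(\zeta_2)|^2\,d\sigma(\zeta_1)\,d\sigma(\zeta_2),$$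 where both sides take values in $[0,\infty]$. If moreover $d\ge3$ and the right-hand side is finite, then equality holds if and only if there exist $c_1,c_2\in\mathbb{C}\setminus\{0\}$ and $\nu\in\mathbb{C}^d$ such that $$f_1(\zeta)=c_1e^{\nu\cdot\zeta}\quad\text{and}\quad f_2(\zeta)=c_2e^{\nu\cdot\zeta}\qquad\text{for }\sigma\text{-a.e. }\zeta\in\mathbb{S}^{d-1},$$ where $\nu\cdot\zeta=\sum_{i=1}^d\nu_i\zeta_i$. -/

import Mathlib

open MeasureTheory
open scoped ENNReal

/-- The unit sphere `𝕊^{d-1}` of `ℝ^d`. -/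
abbrev USphere (d : ℕ) : Type :=
  Metric.sphere (0 : EuclideanSpace ℝ (Fin d)) 1

/-- The standard (not normalized) surface measure `σ = σ_{d-1}` on `𝕊^{d-1} ⊆ ℝ^d`. -/
noncomputable def surfaceMeasure (d : ℕ) : Measure (USphere d) :=
  (volume : Measure (EuclideanSpace ℝ (Fin d))).toSphere

/-- The total surface measure `ω_n` of the `n`-dimensional unit sphere `𝕊^n ⊆ ℝ^{n+1}`. -/
noncomputable def sphereArea (n : ℕ) : ℝ≥0∞ :=
  surfaceMeasure (n + 1) Set.univ

/-- The Fourier transform of the measure `f σ`: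
`ξ ↦ ∫ e^{-i ζ·ξ} f(ζ) dσ(ζ)`. -/
noncomputable def extensionFourier (d : ℕ) (f : USphere d → ℂ)
    (ξ : EuclideanSpace ℝ (Fin d)) : ℂ :=
  ∫ ζ : USphere d,
    Complex.exp (-Complex.I * ((inner ℝ (ζ : EuclideanSpace ℝ (Fin d)) ξ : ℝ) : ℂ)) * f ζ
    ∂(surfaceMeasure d)

/-- The kernel `[(1 - ζ₁·ζ₂)^{d-3} / (1 + ζ₁·ζ₂)]^{1/2}`, with values in `[0, ∞]`
(it is `∞` where a denominator vanishes). -/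
noncomputable def weightKernel (d : ℕ) (ζ₁ ζ₂ : USphere d) : ℝ≥0∞ :=
  (ENNReal.ofReal (1 - inner ℝ (ζ₁ : EuclideanSpace ℝ (Fin d)) (ζ₂ : EuclideanSpace ℝ (Fin d)))
      ^ ((d : ℝ) - 3) /
    ENNReal.ofReal (1 + inner ℝ (ζ₁ : EuclideanSpace ℝ (Fin d)) (ζ₂ : EuclideanSpace ℝ (Fin d))))
    ^ (1 / 2 : ℝ)

/-- The squared norm `‖(f₁σ)^ (f₂σ)^‖²` in `L²(ℝ^d)`, possibly `∞`. -/
noncomputable def bilinearExtensionNormSq (d : ℕ) (f₁ f₂ : USphere d → ℂ) : ℝ≥0∞ :=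
  eLpNorm (fun ξ : EuclideanSpace ℝ (Fin d) => extensionFourier d f₁ ξ * extensionFourier d f₂ ξ)
    2 volume ^ 2

/-- The weighted side
`(2π)^d 2^{(2-d)/2} ω_{d-2} ∫∫ [(1 - ζ₁·ζ₂)^{d-3}/(1 + ζ₁·ζ₂)]^{1/2} |f₁(ζ₁)|² |f₂(ζ₂)|² dσ dσ`,
possibly `∞`; it is used for `d ≥ 2` only. -/
noncomputable def weightedSide (d : ℕ) (f₁ f₂ : USphere d → ℂ) : ℝ≥0∞ :=
  ENNReal.ofReal ((2 * Real.pi) ^ d * (2 : ℝ) ^ ((2 - (d : ℝ)) / 2)) * sphereArea (d - 2) *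
    ∫⁻ p : USphere d × USphere d,
      weightKernel d p.1 p.2 * ‖f₁ p.1‖ₑ ^ 2 * ‖f₂ p.2‖ₑ ^ 2
      ∂((surfaceMeasure d).prod (surfaceMeasure d))

/-! Put `W = σ × σ`, `s (ζ₁, ζ₂) = ζ₁ + ζ₂` and `P = f₁ ⊗ f₂`. The product of the two extensions is
the Fourier transform of the push-forward of `P W` under `s`. By rotation invariance and a
computation in one angle, `s` pushes `W` to an explicit radial density `h`, so `P W` is pushed to `h
F`, where `F ∘ s` is the conditional expectation of `P` given `s`. Plancherel turns the left side
into `(2π)^d ∫ h(s) |E[P | s]|² dW`. As `√h(s)` is a function of `s`, this is `(2π)^d` times the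
squared norm of the `L²` projection of `√h(s) P`, hence at most `(2π)^d ∫ h(s) |P|² dW`. The latter
is the weighted side, because `h(s)` is the kernel up to the stated constant (`eLpNorm_pushFourier`,
`map_add_prod_surfaceMeasure`, `weightedSide_eq`).

When the right side is finite, equality means that `P` is a.e. a function of `ζ₁ + ζ₂`. Exponentials
have this property. Conversely, swapping the variables gives `f₂ = κ f₁`. The Fourier–Laplace
transform of `σ` has gradient parallel to its argument, and this provides test functions on the
product that are orthogonal to every function of `s`. Pairing them with `P` shows that the vectors
`∇L(μ)`, `∇L(ν)`, `ν - μ` in `ℂ^d` are always dependent, where `L` is the transform of `f₁`: the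
lines `μ + ℂ ∇L(μ)` are pairwise coplanar (`minor₃_laplaceGrad_eq_zero`). The gradients span `ℂ^d`,
so for `d ≥ 3` three of them are independent and all these lines share a point `O`
(`exists_common_point`). Then `f₁ e^{O·ζ}` has a radial Fourier transform, so it is constant
(`ae_eq_exp_of_center`). -/

/-! ### Plancherel's identity on `L¹ ∩ L²`. -/

section Plancherel

open FourierTransform SchwartzMap

variable {V : Type*} [NormedAddCommGroup V] [InnerProductSpace ℝ V] [FiniteDimensional ℝ V]
  [MeasurableSpace V] [BorelSpace V]

/-- On `L¹ ∩ L²`, the `L²` Fourier transform is given by the Fourier integral. -/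
theorem Lp_fourier_toLp_ae_eq {f : V → ℂ} (h₁ : Integrable f) (h₂ : MemLp f 2) :
    ((𝓕 (h₂.toLp f) : Lp ℂ 2 (volume : Measure V)) : V → ℂ) =ᵐ[volume] 𝓕 f := by
  have hcont : Continuous (𝓕 f) :=
    VectorFourier.fourierIntegral_continuous Real.continuous_fourierChar
      (by exact continuous_inner) h₁
  -- Both sides are tested against smooth compactly supported functions, where the distributional
  -- definition of the `L²` transform and Fubini for the integral transform give the same pairing.
  refine ae_eq_of_integral_contDiff_smul_eq
    ((Lp.memLp _).locallyIntegrable (by norm_num)) hcont.locallyIntegrable fun g hg hgs => ?_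
  have hg' : ContDiff ℝ (⊤ : ℕ∞) (fun x => (g x : ℂ)) := Complex.ofRealCLM.contDiff.comp hg
  have hgs' : HasCompactSupport (fun x => (g x : ℂ)) :=
    hgs.comp_left (g := fun r : ℝ => (r : ℂ)) (by simp)
  let G : 𝓢(V, ℂ) := hgs'.toSchwartzMap hg'
  have hG : ∀ x, G x = (g x : ℂ) := fun x => rfl
  have key := congrArg (fun T => T G) (Lp.fourier_toTemperedDistribution_eq (h₂.toLp f))
  simp only [TemperedDistribution.fourier_apply, Lp.toTemperedDistribution_apply] at key
  have e1 : ∫ x, g x • (𝓕 (h₂.toLp f) : Lp ℂ 2 (volume : Measure V)) x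
      = ∫ x, G x • (𝓕 (h₂.toLp f) : Lp ℂ 2 (volume : Measure V)) x := by
    simp [hG]
  rw [e1, ← key]
  have e2 : ∫ x, (𝓕 G) x • (h₂.toLp f) x = ∫ x, (𝓕 G) x • f x := by
    refine integral_congr_ae ?_
    filter_upwards [h₂.coeFn_toLp] with x hx
    rw [hx]
  rw [e2]
  have e3 := VectorFourier.integral_fourierIntegral_smul_eq_flip (e := Real.fourierChar)
    (L := innerₗ V) (μ := volume) (ν := volume) (f := (G : V → ℂ)) (g := f)
    Real.continuous_fourierChar (by exact continuous_inner) G.integrable h₁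
  rw [flip_innerₗ] at e3
  calc ∫ x, (𝓕 G) x • f x = ∫ x, G x • (𝓕 f) x := e3
    _ = _ := by simp [hG]

/-- Plancherel's identity for functions in `L¹ ∩ L²`. -/
theorem eLpNorm_fourier_eq {f : V → ℂ} (h₁ : Integrable f) (h₂ : MemLp f 2) :
    eLpNorm (𝓕 f) 2 volume = eLpNorm f 2 volume := by
  rw [← eLpNorm_congr_ae (Lp_fourier_toLp_ae_eq h₁ h₂), ← eLpNorm_congr_ae h₂.coeFn_toLp]
  have := Lp.norm_fourier_eq (h₂.toLp f)
  rw [Lp.norm_def, Lp.norm_def] at this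
  exact (ENNReal.toReal_eq_toReal_iff' (Lp.eLpNorm_ne_top _) (Lp.eLpNorm_ne_top _)).1 this

end Plancherel

/-! ### Fourier uniqueness for push-forwards of densities. -/

section Injectivity

variable {Ω : Type*} [MeasurableSpace Ω] {W : Measure Ω}
  {V : Type*} [NormedAddCommGroup V] [InnerProductSpace ℝ V]
  [SecondCountableTopology V] [MeasurableSpace V] [BorelSpace V]

theorem charFun_map_withDensity_ofReal {s : Ω → V} (hs : Measurable s) {G : Ω → ℝ}
    (hG : Measurable G) (ξ : V) :
    charFun ((W.withDensity fun ω => ENNReal.ofReal (G ω)).map s) ξ =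
      ∫ ω, Complex.exp ((inner ℝ (s ω) ξ : ℝ) * Complex.I) * ((max (G ω) 0 : ℝ) : ℂ) ∂W := by
  rw [charFun_apply, integral_map hs.aemeasurable (by fun_prop),
    integral_withDensity_eq_integral_toReal_smul (by fun_prop) (by simp)]
  refine integral_congr_ae (ae_of_all _ fun ω => ?_)
  simp only [ENNReal.toReal_ofReal', Complex.real_smul]
  ring

/-- The positive and negative parts of `G` push forward to finite measures with equal characteristic
functions, so these measures coincide. -/
theorem setIntegral_preimage_eq_zero_of_charFun_real [CompleteSpace V] {s : Ω → V}
    (hs : Measurable s) {G : Ω → ℝ} (hG : Integrable G W)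
    (h : ∀ ξ : V, ∫ ω, Complex.exp ((inner ℝ (s ω) ξ : ℝ) * Complex.I) * (G ω : ℂ) ∂W = 0)
    {A : Set V} (hA : MeasurableSet A) : ∫ ω in s ⁻¹' A, G ω ∂W = 0 := by
  wlog hGm : Measurable G generalizing G
  · have hae := hG.1.ae_eq_mk
    rw [setIntegral_congr_ae (hs hA) (hae.mono fun x hx _ => hx)]
    refine this (hG.congr hae) (fun ξ => ?_) hG.1.stronglyMeasurable_mk.measurable
    rw [← h ξ]
    refine integral_congr_ae ?_
    filter_upwards [hae] with ω hω
    rw [hω]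
  have hInt : ∀ {K : Ω → ℝ}, Integrable K W → ∀ ξ : V, Integrable
      (fun ω => Complex.exp ((inner ℝ (s ω) ξ : ℝ) * Complex.I) * ((max (K ω) 0 : ℝ) : ℂ)) W := by
    intro K hK ξ
    refine (hK.pos_part.ofReal (𝕜 := ℂ)).bdd_mul (c := 1) (by fun_prop) ?_
    exact ae_of_all _ fun ω => (Complex.norm_exp_ofReal_mul_I _).le
  have hfin : ∀ {K : Ω → ℝ}, Integrable K W →
      IsFiniteMeasure (W.withDensity fun ω => ENNReal.ofReal (K ω)) := fun hK =>
    isFiniteMeasure_withDensity_ofReal hK.2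
  have := hfin hG
  have := hfin hG.neg
  have hmeas : (W.withDensity fun ω => ENNReal.ofReal (G ω)).map s =
      (W.withDensity fun ω => ENNReal.ofReal ((-G) ω)).map s := by
    refine Measure.ext_of_charFun (funext fun ξ => ?_)
    rw [charFun_map_withDensity_ofReal hs hGm, charFun_map_withDensity_ofReal hs hGm.neg,
      ← sub_eq_zero, ← integral_sub (hInt hG ξ) (hInt hG.neg ξ), ← h ξ]
    refine integral_congr_ae (ae_of_all _ fun ω => ?_)
    simp only [Pi.neg_apply, ← mul_sub, ← Complex.ofReal_sub]
    congr 2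
    rcases le_total (G ω) 0 with h0 | h0
    · rw [max_eq_right h0, max_eq_left (by linarith)]; ring
    · rw [max_eq_left h0, max_eq_right (by linarith)]; ring
  have hA' := congrArg (fun μ => μ A) hmeas
  simp only [Measure.map_apply hs hA, withDensity_apply _ (hs hA), Pi.neg_apply] at hA'
  rw [integral_eq_lintegral_pos_part_sub_lintegral_neg_part hG.integrableOn, hA', sub_self]

/-- A complex density whose push-forward under `s` has vanishing characteristic function
integrates to zero over all `s`-measurable sets. -/
theorem setIntegral_preimage_eq_zero_of_charFun [CompleteSpace V] {s : Ω → V}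
    (hs : Measurable s) {G : Ω → ℂ} (hG : Integrable G W)
    (h : ∀ ξ : V, ∫ ω, Complex.exp ((inner ℝ (s ω) ξ : ℝ) * Complex.I) * G ω ∂W = 0)
    {A : Set V} (hA : MeasurableSet A) : ∫ ω in s ⁻¹' A, G ω ∂W = 0 := by
  have hInt : ∀ ξ : V, ∀ K : Ω → ℂ, Integrable K W → Integrable
      (fun ω => Complex.exp ((inner ℝ (s ω) ξ : ℝ) * Complex.I) * K ω) W := by
    intro ξ K hK
    exact hK.bdd_mul (c := 1) (by fun_prop)
      (ae_of_all _ fun ω => (Complex.norm_exp_ofReal_mul_I _).le)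
  have hconj : ∀ ξ : V, ∫ ω, Complex.exp ((inner ℝ (s ω) ξ : ℝ) * Complex.I) *
      (starRingEnd ℂ) (G ω) ∂W = 0 := by
    intro ξ
    -- Conjugation reverses the frequency, so the hypothesis at `-ξ` handles the conjugate density;
    -- real and imaginary parts follow.
    have h1 := congrArg (starRingEnd ℂ) (h (-ξ))
    rw [← integral_conj, map_zero] at h1
    rw [← h1]
    refine integral_congr_ae (ae_of_all _ fun ω => ?_)
    simp [← Complex.exp_conj]
  have hGc : Integrable (fun ω => (starRingEnd ℂ) (G ω)) W :=
    (Complex.conjCLE : ℂ →L[ℝ] ℂ).integrable_comp hG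
  have hre : ∫ ω in s ⁻¹' A, (G ω).re ∂W = 0 := by
    refine setIntegral_preimage_eq_zero_of_charFun_real hs hG.re (fun ξ => ?_) hA
    have h2 := integral_add (hInt ξ _ hG) (hInt ξ _ hGc)
    rw [h ξ, hconj ξ, add_zero] at h2
    have h3 : (fun ω => Complex.exp ((inner ℝ (s ω) ξ : ℝ) * Complex.I) * ((G ω).re : ℂ)) =
        fun ω => (1 / 2 : ℂ) * (Complex.exp ((inner ℝ (s ω) ξ : ℝ) * Complex.I) * G ω +
          Complex.exp ((inner ℝ (s ω) ξ : ℝ) * Complex.I) * (starRingEnd ℂ) (G ω)) := by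
      funext ω
      rw [Complex.re_eq_add_conj]; ring
    refine (congrArg (fun f => ∫ ω, f ω ∂W) h3).trans ?_
    rw [integral_const_mul, h2, mul_zero]
  have him : ∫ ω in s ⁻¹' A, (G ω).im ∂W = 0 := by
    refine setIntegral_preimage_eq_zero_of_charFun_real hs hG.im (fun ξ => ?_) hA
    have h2 := integral_sub (hInt ξ _ hG) (hInt ξ _ hGc)
    rw [h ξ, hconj ξ, sub_zero] at h2
    have h3 : (fun ω => Complex.exp ((inner ℝ (s ω) ξ : ℝ) * Complex.I) * ((G ω).im : ℂ)) =
        fun ω => (1 / (2 * Complex.I) : ℂ) *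
          (Complex.exp ((inner ℝ (s ω) ξ : ℝ) * Complex.I) * G ω -
          Complex.exp ((inner ℝ (s ω) ξ : ℝ) * Complex.I) * (starRingEnd ℂ) (G ω)) := by
      funext ω
      rw [Complex.im_eq_sub_conj]; ring
    refine (congrArg (fun f => ∫ ω, f ω ∂W) h3).trans ?_
    rw [integral_const_mul, h2, mul_zero]
  rw [← integral_re_add_im hG.integrableOn]
  simp only [RCLike.re_to_complex, RCLike.im_to_complex]
  rw [hre, him]
  simp

/-- Fourier uniqueness for densities with respect to a measure on a subset of `V`. -/
theorem ae_eq_zero_of_charFun [CompleteSpace V] {s : Ω → V} (hs : MeasurableEmbedding s)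
    {G : Ω → ℂ} (hG : Integrable G W)
    (h : ∀ ξ : V, ∫ ω, Complex.exp ((inner ℝ (s ω) ξ : ℝ) * Complex.I) * G ω ∂W = 0) :
    G =ᵐ[W] 0 := by
  refine hG.ae_eq_zero_of_forall_setIntegral_eq_zero fun B hB _ => ?_
  have := setIntegral_preimage_eq_zero_of_charFun hs.measurable hG h (hs.measurableSet_image.2 hB)
  rwa [hs.injective.preimage_image] at this

/-- A complex density whose push-forward under `s` has vanishing characteristic function
is orthogonal to all functions of `s`. -/
theorem integral_mul_eq_zero_of_charFun [CompleteSpace V] [IsFiniteMeasure W] {s : Ω → V}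
    (hs : Measurable s) {G K : Ω → ℂ} (hG : Integrable G W)
    (hK : AEStronglyMeasurable[MeasurableSpace.comap s inferInstance] K W)
    (hKG : Integrable (fun ω => K ω * G ω) W)
    (h : ∀ ξ : V, ∫ ω, Complex.exp ((inner ℝ (s ω) ξ : ℝ) * Complex.I) * G ω ∂W = 0) :
    ∫ ω, K ω * G ω ∂W = 0 := by
  have hm := hs.comap_le
  -- `G` integrates to zero over every set of the σ-algebra of `s`, so its conditional expectation
  -- vanishes; `K` can then be pulled out.
  have h0 : (0 : Ω → ℂ) =ᵐ[W] W[G | MeasurableSpace.comap s inferInstance] := by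
    refine ae_eq_condExp_of_forall_setIntegral_eq hm hG (fun _ _ _ => integrableOn_zero) ?_
      aestronglyMeasurable_zero
    rintro B ⟨A, hA, rfl⟩ -
    rw [setIntegral_preimage_eq_zero_of_charFun hs hG h hA]
    simp
  have h1 := condExp_bilin_of_aestronglyMeasurable_left (ContinuousLinearMap.mul ℝ ℂ) hK hKG hG
  rw [← integral_condExp hm]
  refine integral_eq_zero_of_ae ?_
  filter_upwards [h0, h1] with ω h0 h1
  simp only [ContinuousLinearMap.mul_apply'] at h1
  rw [h1, ← h0]
  simp

end Injectivity

/-! ### Polar coordinates for an additive Haar measure. -/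

section PolarCoordinates

variable {V : Type*} [NormedAddCommGroup V] [NormedSpace ℝ V] [FiniteDimensional ℝ V]
  [MeasurableSpace V] [BorelSpace V] [Nontrivial V] (μ : Measure V) [μ.IsAddHaarMeasure]

/-- Integration in polar coordinates. -/
theorem lintegral_eq_lintegral_toSphere {f : V → ℝ≥0∞} (hf : Measurable f) :
    ∫⁻ x, f x ∂μ = ∫⁻ ζ, ∫⁻ r in Set.Ioi (0 : ℝ),
      ENNReal.ofReal (r ^ (Module.finrank ℝ V - 1)) * f (r • (ζ : V)) ∂volume ∂μ.toSphere := by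
  have h1 : ∫⁻ x, f x ∂μ = ∫⁻ x : ({0}ᶜ : Set V), f x ∂(μ.comap (↑)) := by
    rw [lintegral_subtype_comap (measurableSet_singleton _).compl, restrict_compl_singleton]
  have h2 := (μ.measurePreserving_homeomorphUnitSphereProd).lintegral_comp_emb
    (Homeomorph.measurableEmbedding _)
    (fun p => f (((homeomorphUnitSphereProd V).symm p : ({0}ᶜ : Set V)) : V))
  simp only [Homeomorph.symm_apply_apply] at h2
  rw [h1, h2, lintegral_prod _ (by fun_prop)]
  refine lintegral_congr fun ζ => ?_
  simp only [homeomorphUnitSphereProd_symm_apply_coe, Measure.volumeIoiPow]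
  rw [lintegral_withDensity_eq_lintegral_mul _ (by fun_prop) (by fun_prop)]
  exact lintegral_subtype_comap measurableSet_Ioi
    (fun r : ℝ => ENNReal.ofReal (r ^ (Module.finrank ℝ V - 1)) * f (r • (ζ : V)))

theorem lintegral_fun_norm_toSphere {f : ℝ → ℝ≥0∞} (hf : Measurable f) :
    ∫⁻ x, f ‖x‖ ∂μ = μ.toSphere Set.univ * ∫⁻ r in Set.Ioi (0 : ℝ),
      ENNReal.ofReal (r ^ (Module.finrank ℝ V - 1)) * f r := by
  rw [lintegral_eq_lintegral_toSphere μ (by fun_prop : Measurable fun x : V => f ‖x‖), mul_comm,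
    ← lintegral_const]
  refine lintegral_congr fun ζ => setLIntegral_congr_fun measurableSet_Ioi fun r hr => ?_
  simp [norm_smul, abs_of_pos (Set.mem_Ioi.1 hr)]

end PolarCoordinates

/-! ### Rotation invariance and zonal integrals on the sphere. -/

section Sphere

variable {d : ℕ}

local notation "𝔼" d => EuclideanSpace ℝ (Fin d)

instance (d : ℕ) : IsFiniteMeasure (surfaceMeasure d) := by
  unfold surfaceMeasure; infer_instance

/-- The action of a linear isometry on the unit sphere. -/
noncomputable def sphereMap (R : (𝔼 d) ≃ₗᵢ[ℝ] (𝔼 d)) (ζ : USphere d) : USphere d :=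
  ⟨R ζ, by simp⟩

@[simp]
theorem coe_sphereMap (R : (𝔼 d) ≃ₗᵢ[ℝ] (𝔼 d)) (ζ : USphere d) :
    (sphereMap R ζ : 𝔼 d) = R ζ := rfl

theorem continuous_sphereMap (R : (𝔼 d) ≃ₗᵢ[ℝ] (𝔼 d)) : Continuous (sphereMap R) := by
  unfold sphereMap; fun_prop

open Pointwise in
/-- The surface measure is rotation invariant. -/
theorem measurePreserving_sphereMap (R : (𝔼 d) ≃ₗᵢ[ℝ] (𝔼 d)) :
    MeasurePreserving (sphereMap R) (surfaceMeasure d) (surfaceMeasure d) := by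
  refine ⟨(continuous_sphereMap R).measurable, Measure.ext fun A hA => ?_⟩
  have hA' := (continuous_sphereMap R).measurable hA
  rw [Measure.map_apply (continuous_sphereMap R).measurable hA, surfaceMeasure,
    Measure.toSphere_apply' _ hA, Measure.toSphere_apply' _ hA']
  congr 1
  have h : Set.Ioo (0 : ℝ) 1 • (((↑) : USphere d → 𝔼 d) '' (sphereMap R ⁻¹' A)) =
      R ⁻¹' (Set.Ioo (0 : ℝ) 1 • (((↑) : USphere d → 𝔼 d) '' A)) := by
    ext x
    simp only [Set.mem_smul, Set.mem_image, Set.mem_preimage]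
    constructor
    · rintro ⟨r, hr, _, ⟨ζ, hζ, rfl⟩, rfl⟩
      exact ⟨r, hr, _, ⟨_, hζ, rfl⟩, by simp⟩
    · rintro ⟨r, hr, _, ⟨ζ, hζ, rfl⟩, hx⟩
      refine ⟨r, hr, _, ⟨sphereMap R.symm ζ, ?_, rfl⟩, ?_⟩
      · convert hζ
        ext1
        simp
      · simp [← map_smul, hx]
  rw [h]
  exact (R.measurePreserving).measure_preimage_emb R.toHomeomorph.measurableEmbedding _

theorem exists_linearIsometryEquiv_apply_eq {x y : 𝔼 d} (h : ‖x‖ = ‖y‖) :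
    ∃ R : (𝔼 d) ≃ₗᵢ[ℝ] (𝔼 d), R x = y :=
  ⟨_, Submodule.reflection_sub h⟩

theorem measurePreserving_toLp_cons (n : ℕ) :
    MeasurePreserving
      (fun p : ℝ × (𝔼 n) => (WithLp.toLp 2 (Fin.cons p.1 p.2.ofLp : Fin (n + 1) → ℝ)))
      volume volume := by
  have h1 := (PiLp.volume_preserving_toLp (Fin (n + 1)))
  have h2 := (volume_preserving_piFinSuccAbove (fun _ : Fin (n + 1) => ℝ) 0).symm
  have h3 := (MeasurePreserving.id (volume : Measure ℝ)).prod (PiLp.volume_preserving_ofLp (Fin n))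
  have h4 := h1.comp (h2.comp h3)
  have h5 : (fun p : ℝ × (𝔼 n) => (WithLp.toLp 2 (Fin.cons p.1 p.2.ofLp : Fin (n + 1) → ℝ))) =
      WithLp.toLp 2 ∘ (MeasurableEquiv.piFinSuccAbove (fun _ : Fin (n + 1) => ℝ) 0).symm ∘
        Prod.map id WithLp.ofLp := by
    funext p
    simp [MeasurableEquiv.piFinSuccAbove, Fin.insertNthEquiv]
  rw [h5]
  exact h4

theorem lintegral_fun_coord_norm {n : ℕ} {g : ℝ → ℝ → ℝ≥0∞} (hg : Measurable (Function.uncurry g)) :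
    ∫⁻ x : 𝔼 (n + 1), g (x 0) ‖x‖ = ∫⁻ t : ℝ, ∫⁻ y : 𝔼 n, g t (√(t ^ 2 + ‖y‖ ^ 2)) := by
  have hmeas : Measurable fun x : 𝔼 (n + 1) => g (x 0) ‖x‖ :=
    hg.comp (by fun_prop : Measurable fun x : 𝔼 (n + 1) => (x 0, ‖x‖))
  rw [← (measurePreserving_toLp_cons n).lintegral_comp hmeas]
  have : ∀ p : ℝ × (𝔼 n), ‖(WithLp.toLp 2 (Fin.cons p.1 p.2.ofLp : Fin (n + 1) → ℝ))‖ =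
      √(p.1 ^ 2 + ‖p.2‖ ^ 2) := by
    intro p
    simp [EuclideanSpace.norm_eq, Fin.sum_univ_succ, Real.sq_sqrt, Finset.sum_nonneg, sq_nonneg]
  simp only [this, Fin.cons_zero]
  exact lintegral_prod _ (hg.comp (by fun_prop :
    Measurable fun p : ℝ × (𝔼 n) => (p.1, √(p.1 ^ 2 + ‖p.2‖ ^ 2)))).aemeasurable

/-- Integration of a function of the first coordinate over the sphere. -/
theorem lintegral_coord_surfaceMeasure {n : ℕ} {φ : ℝ → ℝ≥0∞} (hφ : Measurable φ) :
    ∫⁻ ζ : USphere (n + 2), φ ((ζ : 𝔼 (n + 2)) 0) ∂(surfaceMeasure (n + 2)) =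
      sphereArea n * ∫⁻ θ in Set.Ioo 0 Real.pi,
        ENNReal.ofReal (Real.sin θ ^ n) * φ (Real.cos θ) := by
  set c : ℝ≥0∞ := ∫⁻ r in Set.Ioo (0 : ℝ) 1, ENNReal.ofReal (r ^ (n + 1)) with hc
  have hcv : c = ENNReal.ofReal (1 / (n + 2)) := by
    rw [hc, Measure.restrict_congr_set Ioo_ae_eq_Ioc,
      ← ofReal_integral_eq_lintegral_ofReal (intervalIntegral.intervalIntegrable_pow _).1,
      ← intervalIntegral.integral_of_le zero_le_one]
    · norm_num [add_assoc]
    · filter_upwards [ae_restrict_mem measurableSet_Ioc] with y hy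
      exact pow_nonneg hy.1.le _
  have hc0 : c ≠ 0 := by
    rw [hcv]
    exact (ENNReal.ofReal_pos.2 (by positivity)).ne'
  have hctop : c ≠ ∞ := by
    rw [hcv]
    exact ENNReal.ofReal_ne_top
  -- The integral over the unit ball of the degree-zero extension of `φ` is computed twice: in
  -- spherical coordinates (`hL`), and by slicing along the first axis and taking planar polar
  -- coordinates (`hR`). The common radial factor `c` cancels.
  let g : ℝ → ℝ → ℝ≥0∞ := fun t r => (Set.Iio (1 : ℝ)).indicator (fun _ => φ (t / r)) r
  have hg : Measurable (Function.uncurry g) := by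
    have : Function.uncurry g = (Set.indicator {p : ℝ × ℝ | p.2 < 1} fun p => φ (p.1 / p.2)) := by
      funext p; simp [g, Function.uncurry, Set.indicator]
    rw [this]
    exact (by fun_prop : Measurable fun p : ℝ × ℝ => φ (p.1 / p.2)).indicator
      (measurableSet_lt measurable_snd measurable_const)
  have hL : ∫⁻ x : 𝔼 (n + 2), g (x 0) ‖x‖ =
      c * ∫⁻ ζ : USphere (n + 2), φ ((ζ : 𝔼 (n + 2)) 0) ∂(surfaceMeasure (n + 2)) := by
    have hmeas : Measurable fun x : 𝔼 (n + 2) => g (x 0) ‖x‖ :=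
      hg.comp (by fun_prop : Measurable fun x : 𝔼 (n + 2) => (x 0, ‖x‖))
    rw [lintegral_eq_lintegral_toSphere volume hmeas, surfaceMeasure,
      ← lintegral_const_mul _ (by fun_prop)]
    refine lintegral_congr fun ζ => ?_
    rw [hc, ← lintegral_mul_const _ (by fun_prop)]
    have : Set.Ioo (0 : ℝ) 1 = Set.Iio 1 ∩ Set.Ioi 0 := by ext; simp [and_comm]
    rw [this, ← Measure.restrict_restrict measurableSet_Iio,
      ← lintegral_indicator measurableSet_Iio]
    refine setLIntegral_congr_fun measurableSet_Ioi fun r hr => ?_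
    have hr : 0 < r := hr
    by_cases h1 : r < 1 <;> simp [g, norm_smul, abs_of_pos hr, h1, hr.ne']
  have hR : ∫⁻ t : ℝ, ∫⁻ y : 𝔼 (n + 1), g t (√(t ^ 2 + ‖y‖ ^ 2)) =
      c * (sphereArea n * ∫⁻ θ in Set.Ioo 0 Real.pi,
        ENNReal.ofReal (Real.sin θ ^ n) * φ (Real.cos θ)) := by
    let G : ℝ × ℝ → ℝ≥0∞ := fun p => (Set.Ioi (0 : ℝ)).indicator
      (fun ρ => ENNReal.ofReal (ρ ^ n) * g p.1 (√(p.1 ^ 2 + ρ ^ 2))) p.2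
    have hG : Measurable G := by
      have : G = (Set.indicator {p : ℝ × ℝ | 0 < p.2} fun p =>
          ENNReal.ofReal (p.2 ^ n) * g p.1 (√(p.1 ^ 2 + p.2 ^ 2))) := by
        funext p; simp [G, Set.indicator]
      rw [this]
      refine Measurable.indicator (Measurable.mul (by fun_prop) ?_)
        (measurableSet_lt measurable_const measurable_snd)
      exact hg.comp (by fun_prop : Measurable fun p : ℝ × ℝ => (p.1, √(p.1 ^ 2 + p.2 ^ 2)))
    have h1 : ∀ t : ℝ, ∫⁻ y : 𝔼 (n + 1), g t (√(t ^ 2 + ‖y‖ ^ 2)) =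
        sphereArea n * ∫⁻ ρ : ℝ, G (t, ρ) := by
      intro t
      rw [lintegral_fun_norm_toSphere volume (f := fun ρ => g t (√(t ^ 2 + ρ ^ 2)))
        (hg.comp (by fun_prop : Measurable fun ρ : ℝ => (t, √(t ^ 2 + ρ ^ 2))))]
      simp only [G]
      rw [lintegral_indicator measurableSet_Ioi]
      simp [sphereArea, surfaceMeasure]
    simp only [h1]
    rw [lintegral_const_mul _ hG.lintegral_prod_right, ← mul_assoc, mul_comm c, mul_assoc]
    congr 1
    rw [← lintegral_prod _ hG.aemeasurable]
    change ∫⁻ p, G p = _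
    rw [← lintegral_comp_polarCoord_symm, polarCoord_target]
    -- With `t = r cos θ` and `ρ = r sin θ`, the condition `ρ > 0` leaves `θ ∈ (0, π)`; the Jacobian
    -- `r` and the factor `ρ ^ n` combine to `r ^ (n + 1) sin θ ^ n`.
    have h2 : ∀ p ∈ Set.Ioi (0 : ℝ) ×ˢ Set.Ioo (-Real.pi) Real.pi,
        ENNReal.ofReal p.1 • G (polarCoord.symm p) =
        (Set.Iio (1 : ℝ)).indicator (fun r => ENNReal.ofReal (r ^ (n + 1))) p.1 *
        (Set.Ioi (0 : ℝ)).indicator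
          (fun θ => ENNReal.ofReal (Real.sin θ ^ n) * φ (Real.cos θ)) p.2 := by
      rintro ⟨r, θ⟩ ⟨hr, hθ⟩
      replace hr : 0 < r := hr
      have hsq : √((r * Real.cos θ) ^ 2 + (r * Real.sin θ) ^ 2) = r := by
        rw [mul_pow, mul_pow, ← mul_add, Real.cos_sq_add_sin_sq, mul_one, Real.sqrt_sq hr.le]
      simp only [polarCoord_symm_apply, G, g, Set.indicator_apply, Set.mem_Ioi, Set.mem_Iio]
      rw [hsq]
      by_cases h0 : 0 < θ
      · have hs : 0 < Real.sin θ := Real.sin_pos_of_pos_of_lt_pi h0 hθ.2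
        rw [if_pos h0, if_pos (mul_pos hr hs), mul_div_cancel_left₀ _ hr.ne']
        split_ifs
        · rw [smul_eq_mul, ← mul_assoc, ← mul_assoc, ← ENNReal.ofReal_mul hr.le,
            ← ENNReal.ofReal_mul (by positivity)]
          congr 2
          ring
        · simp
      · have hs : Real.sin θ ≤ 0 := Real.sin_nonpos_of_nonpos_of_neg_pi_le (not_lt.1 h0) hθ.1.le
        rw [if_neg h0, if_neg (by nlinarith)]
        simp
    rw [setLIntegral_congr_fun (measurableSet_Ioi.prod measurableSet_Ioo) h2,
      Measure.volume_eq_prod, ← Measure.prod_restrict, lintegral_prod_mul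
        (Measurable.aemeasurable (Measurable.indicator (by fun_prop) measurableSet_Iio))
        (Measurable.aemeasurable (Measurable.indicator (by fun_prop) measurableSet_Ioi)),
      lintegral_indicator measurableSet_Iio, lintegral_indicator measurableSet_Ioi,
      Measure.restrict_restrict measurableSet_Iio, Measure.restrict_restrict measurableSet_Ioi,
      Set.inter_comm, Set.Ioi_inter_Iio, Set.Ioi_inter_Ioo, max_eq_left]
    linarith [Real.pi_pos]
  have := hL.symm.trans ((lintegral_fun_coord_norm hg).trans hR)
  exact (ENNReal.mul_right_inj hc0 hctop).1 this

end Sphere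

/-! ### The law of the sum of two points of the sphere. -/

section SumLaw

variable {d : ℕ}

local notation "𝔼" d => EuclideanSpace ℝ (Fin d)

theorem lintegral_comp_sphereMap (R : (𝔼 d) ≃ₗᵢ[ℝ] (𝔼 d)) {φ : USphere d → ℝ≥0∞}
    (hφ : Measurable φ) :
    ∫⁻ ζ, φ (sphereMap R ζ) ∂(surfaceMeasure d) = ∫⁻ ζ, φ ζ ∂(surfaceMeasure d) :=
  (measurePreserving_sphereMap R).lintegral_comp hφ

theorem integral_comp_sphereMap (R : (𝔼 d) ≃ₗᵢ[ℝ] (𝔼 d)) (φ : USphere d → ℂ) :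
    ∫ ζ, φ (sphereMap R ζ) ∂(surfaceMeasure d) = ∫ ζ, φ ζ ∂(surfaceMeasure d) := by
  refine (measurePreserving_sphereMap R).integral_comp' (f := MeasurableEquiv.mk
    ⟨sphereMap R, sphereMap R.symm, fun ζ => ?_, fun ζ => ?_⟩
    (continuous_sphereMap R).measurable (continuous_sphereMap R.symm).measurable) φ
  · ext1; simp
  · ext1; simp

theorem surfaceMeasure_ne_zero [NeZero d] : surfaceMeasure d ≠ 0 := by
  unfold surfaceMeasure
  exact Measure.toSphere_ne_zero _

/-- The value at `r • e` of the Fourier transform of the surface measure does not depend on the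
unit vector `e`. -/
theorem integral_exp_inner_eq (r : ℝ) {x y : 𝔼 d} (h : ‖x‖ = ‖y‖) :
    ∫ ζ : USphere d, Complex.exp ((inner ℝ x (r • (ζ : 𝔼 d)) : ℝ) * Complex.I) ∂(surfaceMeasure d) =
    ∫ ζ : USphere d, Complex.exp ((inner ℝ y (r • (ζ : 𝔼 d)) : ℝ) * Complex.I)
      ∂(surfaceMeasure d) := by
  obtain ⟨R, rfl⟩ := exists_linearIsometryEquiv_apply_eq h
  rw [← integral_comp_sphereMap R fun ζ : USphere d =>
    Complex.exp ((inner ℝ (R x) (r • (ζ : 𝔼 d)) : ℝ) * Complex.I)]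
  simp only [coe_sphereMap, ← map_smul, LinearIsometryEquiv.inner_map_map]

/-- The characteristic function is radial, so it equals its average over the sphere of radius `‖ξ‖`.
After Fubini the inner average depends on the integration point only through its norm. -/
theorem charFun_of_rotationInvariant [NeZero d] {μ : Measure (𝔼 d)} [IsFiniteMeasure μ]
    (hμ : ∀ R : (𝔼 d) ≃ₗᵢ[ℝ] (𝔼 d), μ.map R = μ) (e : USphere d) (ξ : 𝔼 d) :
    (surfaceMeasure d).real Set.univ • charFun μ ξ = ∫ t : ℝ, ∫ ζ : USphere d,
      Complex.exp ((inner ℝ (t • (e : 𝔼 d)) (‖ξ‖ • (ζ : 𝔼 d)) : ℝ) * Complex.I)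
        ∂(surfaceMeasure d) ∂(μ.map norm) := by
  have h1 : ∀ ζ : USphere d, charFun μ (‖ξ‖ • (ζ : 𝔼 d)) = charFun μ ξ := by
    intro ζ
    obtain ⟨R, hR⟩ := exists_linearIsometryEquiv_apply_eq
      (x := ξ) (y := ‖ξ‖ • (ζ : 𝔼 d)) (by simp [norm_smul])
    rw [← hR]
    conv_lhs => rw [← hμ R]
    rw [charFun_apply, charFun_apply, integral_map R.continuous.aemeasurable (by fun_prop)]
    simp
  have hInt : Integrable (fun p : USphere d × (𝔼 d) =>
      Complex.exp ((inner ℝ p.2 (‖ξ‖ • (p.1 : 𝔼 d)) : ℝ) * Complex.I))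
      ((surfaceMeasure d).prod μ) := by
    refine Integrable.of_bound (by fun_prop) 1 (ae_of_all _ fun p => ?_)
    exact (Complex.norm_exp_ofReal_mul_I _).le
  have hcont : Continuous fun t : ℝ => ∫ ζ : USphere d,
      Complex.exp ((inner ℝ (t • (e : 𝔼 d)) (‖ξ‖ • (ζ : 𝔼 d)) : ℝ) * Complex.I)
        ∂(surfaceMeasure d) := by
    refine continuous_of_dominated (bound := fun _ => 1) (fun t => by fun_prop)
      (fun t => ae_of_all _ fun ζ => (Complex.norm_exp_ofReal_mul_I _).le) (integrable_const _)
      (ae_of_all _ fun ζ => by fun_prop)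
  calc (surfaceMeasure d).real Set.univ • charFun μ ξ
      = ∫ ζ : USphere d, charFun μ (‖ξ‖ • (ζ : 𝔼 d)) ∂(surfaceMeasure d) := by
        simp only [h1, integral_const]
    _ = ∫ x, ∫ ζ : USphere d, Complex.exp ((inner ℝ x (‖ξ‖ • (ζ : 𝔼 d)) : ℝ) * Complex.I)
          ∂(surfaceMeasure d) ∂μ := integral_integral_swap hInt
    _ = _ := by
        rw [integral_map (by fun_prop) hcont.aestronglyMeasurable]
        refine integral_congr_ae (ae_of_all _ fun x => integral_exp_inner_eq _ ?_)
        simp [norm_smul]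

/-- A finite rotation invariant measure is determined by its radial distribution. -/
theorem ext_of_rotationInvariant [NeZero d] {μ ν : Measure (𝔼 d)} [IsFiniteMeasure μ]
    [IsFiniteMeasure ν] (hμ : ∀ R : (𝔼 d) ≃ₗᵢ[ℝ] (𝔼 d), μ.map R = μ)
    (hν : ∀ R : (𝔼 d) ≃ₗᵢ[ℝ] (𝔼 d), ν.map R = ν) (h : μ.map norm = ν.map norm) : μ = ν := by
  have hd : 0 < (surfaceMeasure d).real Set.univ := by
    rw [measureReal_def]
    exact ENNReal.toReal_pos (by simpa using surfaceMeasure_ne_zero) (measure_ne_top _ _)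
  obtain ⟨e⟩ : Nonempty (USphere d) := by
    by_contra hne
    rw [not_nonempty_iff] at hne
    simp [Set.univ_eq_empty_iff.2 hne] at hd
  refine Measure.ext_of_charFun (funext fun ξ => ?_)
  have h1 := charFun_of_rotationInvariant hμ e ξ
  rw [h, ← charFun_of_rotationInvariant hν e ξ] at h1
  exact smul_right_injective ℂ hd.ne' h1

/-- The radial profile of the density of `σ ∗ σ` on `ℝ^{n+2}`. -/
noncomputable def sumProfile (n : ℕ) (r : ℝ) : ℝ :=
  (Set.Ioo (0 : ℝ) 2).indicator (fun r => r⁻¹ * (1 - r ^ 2 / 4) ^ (((n : ℝ) - 1) / 2)) r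

theorem measurable_sumProfile (n : ℕ) : Measurable (sumProfile n) :=
  Measurable.indicator (by fun_prop) measurableSet_Ioo

theorem image_two_mul_cos_half :
    (fun θ => 2 * Real.cos (θ / 2)) '' Set.Ioo 0 Real.pi = Set.Ioo 0 2 := by
  ext r
  constructor
  · rintro ⟨θ, ⟨h0, h1⟩, rfl⟩
    have hc : 0 < Real.cos (θ / 2) := Real.cos_pos_of_mem_Ioo ⟨by linarith, by linarith⟩
    have hc' : Real.cos (θ / 2) < 1 := by
      rw [← Real.cos_zero]
      exact Real.cos_lt_cos_of_nonneg_of_le_pi le_rfl (by linarith) (by linarith)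
    exact ⟨by simpa using hc, by simp only; linarith⟩
  · rintro ⟨h0, h2⟩
    refine ⟨2 * Real.arccos (r / 2), ⟨?_, ?_⟩, ?_⟩
    · have := Real.arccos_pos.2 (by linarith : r / 2 < 1)
      linarith
    · have := Real.arccos_lt_pi_div_two.2 (by linarith : 0 < r / 2)
      linarith
    · simp only [mul_div_cancel_left₀ _ (two_ne_zero' ℝ)]
      rw [Real.cos_arccos (by linarith) (by linarith)]
      ring

/-- Substitution `r = 2 cos (θ / 2)`, under which `sin (θ / 2) = √(1 - r² / 4)` and `sin θ = r sin
(θ / 2)`; dividing by the derivative `sin (θ / 2)` lowers the exponent of the profile from `n / 2`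
to `(n - 1) / 2`. -/
theorem lintegral_sin_pow_two_mul_cos_half (n : ℕ) (φ : ℝ → ℝ≥0∞) :
    ∫⁻ θ in Set.Ioo 0 Real.pi, ENNReal.ofReal (Real.sin θ ^ n) * φ (2 * Real.cos (θ / 2)) =
      ∫⁻ r in Set.Ioo (0 : ℝ) 2, ENNReal.ofReal (r ^ (n + 1) * sumProfile n r) * φ r := by
  have hderiv : ∀ θ ∈ Set.Ioo 0 Real.pi, HasDerivWithinAt (fun θ => 2 * Real.cos (θ / 2))
      (-Real.sin (θ / 2)) (Set.Ioo 0 Real.pi) θ := by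
    intro θ _
    have : HasDerivAt (fun θ => 2 * Real.cos (θ / 2)) (2 * (-Real.sin (θ / 2) * (1 / 2))) θ :=
      ((hasDerivAt_id' θ).div_const 2).cos.const_mul 2
    exact (this.congr_deriv (by ring)).hasDerivWithinAt
  have hinj : Set.InjOn (fun θ => 2 * Real.cos (θ / 2)) (Set.Ioo 0 Real.pi) := by
    intro a ha b hb hab
    have := Real.injOn_cos (x₁ := a / 2) (x₂ := b / 2)
      ⟨by linarith [ha.1], by linarith [ha.2, Real.pi_pos]⟩
      ⟨by linarith [hb.1], by linarith [hb.2, Real.pi_pos]⟩ (by simpa using hab)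
    linarith
  rw [← image_two_mul_cos_half, lintegral_image_eq_lintegral_abs_deriv_mul measurableSet_Ioo
    hderiv hinj]
  refine setLIntegral_congr_fun measurableSet_Ioo fun θ hθ => ?_
  have hmem : 2 * Real.cos (θ / 2) ∈ Set.Ioo (0 : ℝ) 2 :=
    image_two_mul_cos_half ▸ Set.mem_image_of_mem _ hθ
  have hs : 0 < Real.sin (θ / 2) :=
    Real.sin_pos_of_pos_of_lt_pi (by linarith [hθ.1]) (by linarith [hθ.2, Real.pi_pos])
  have hc : 0 < Real.cos (θ / 2) := by have := hmem.1; linarith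
  rw [← mul_assoc, ← ENNReal.ofReal_mul (abs_nonneg _)]
  congr 2
  rw [sumProfile, Set.indicator_of_mem hmem, abs_neg, abs_of_pos hs]
  have h1 : 1 - (2 * Real.cos (θ / 2)) ^ 2 / 4 = Real.sin (θ / 2) ^ (2 : ℝ) := by
    rw [Real.rpow_two, Real.sin_sq]; ring
  have h2 : Real.sin θ = 2 * Real.sin (θ / 2) * Real.cos (θ / 2) := by
    rw [← Real.sin_two_mul]; congr 1; ring
  rw [h1, ← Real.rpow_mul hs.le, h2, show (2 : ℝ) * (((n : ℝ) - 1) / 2) = n - 1 by ring,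
    Real.rpow_sub_one hs.ne', Real.rpow_natCast]
  field_simp
  ring

/-- Rotating `η` to the first basis vector makes the integrand zonal: at angle `θ` from `η` the sum
has norm `√(2 + 2 cos θ) = 2 cos (θ / 2)`. -/
theorem lintegral_norm_add_surfaceMeasure {n : ℕ} (η : USphere (n + 2)) {φ : ℝ → ℝ≥0∞}
    (hφ : Measurable φ) :
    ∫⁻ ζ : USphere (n + 2), φ ‖(η : 𝔼 (n + 2)) + ζ‖ ∂(surfaceMeasure (n + 2)) =
      sphereArea n *
        ∫⁻ r in Set.Ioo (0 : ℝ) 2, ENNReal.ofReal (r ^ (n + 1) * sumProfile n r) * φ r := by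
  have he : ‖(EuclideanSpace.single 0 1 : 𝔼 (n + 2))‖ = ‖(η : 𝔼 (n + 2))‖ := by simp
  obtain ⟨R, hR⟩ := exists_linearIsometryEquiv_apply_eq he
  rw [← hR, ← lintegral_comp_sphereMap R (φ := fun ζ : USphere (n + 2) =>
    φ ‖R (EuclideanSpace.single 0 1 : 𝔼 (n + 2)) + ζ‖) (by fun_prop)]
  simp only [coe_sphereMap, ← map_add, LinearIsometryEquiv.norm_map]
  have h1 : ∀ ζ : USphere (n + 2), ‖(EuclideanSpace.single 0 1 : 𝔼 (n + 2)) + ζ‖ =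
      √(2 + 2 * (ζ : 𝔼 (n + 2)) 0) := by
    intro ζ
    rw [← Real.sqrt_sq (norm_nonneg _), norm_add_sq_real]
    simp [EuclideanSpace.inner_single_left]
    ring_nf
  simp only [h1]
  rw [lintegral_coord_surfaceMeasure (φ := fun t => φ √(2 + 2 * t)) (by fun_prop),
    ← lintegral_sin_pow_two_mul_cos_half]
  congr 1
  refine setLIntegral_congr_fun measurableSet_Ioo fun θ hθ => ?_
  have hc : 0 < Real.cos (θ / 2) :=
    Real.cos_pos_of_mem_Ioo ⟨by linarith [hθ.1, Real.pi_pos], by linarith [hθ.2]⟩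
  have : 2 + 2 * Real.cos θ = (2 * Real.cos (θ / 2)) ^ 2 := by
    rw [mul_pow, Real.cos_sq, mul_div_cancel₀ _ (two_ne_zero' ℝ)]; ring
  simp only [this, Real.sqrt_sq (by positivity : 0 ≤ 2 * Real.cos (θ / 2))]

theorem measurable_sphere_add :
    Measurable fun p : USphere d × USphere d => (p.1 : 𝔼 d) + p.2 := by fun_prop

/-- The density of `σ ∗ σ` with respect to Lebesgue measure on `ℝ^{n+2}`. -/
theorem map_add_prod_surfaceMeasure (n : ℕ) :
    ((surfaceMeasure (n + 2)).prod (surfaceMeasure (n + 2))).map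
      (fun p => (p.1 : 𝔼 (n + 2)) + p.2) =
    (volume : Measure (𝔼 (n + 2))).withDensity
      fun x => sphereArea n * ENNReal.ofReal (sumProfile n ‖x‖) := by
  have hp := measurable_sumProfile n
  have hmeas : Measurable fun x : 𝔼 (n + 2) =>
      sphereArea n * ENNReal.ofReal (sumProfile n ‖x‖) := by fun_prop
  have hnorm : (((surfaceMeasure (n + 2)).prod (surfaceMeasure (n + 2))).map
      (fun p => (p.1 : 𝔼 (n + 2)) + p.2)).map norm =
      ((volume : Measure (𝔼 (n + 2))).withDensity
        fun x => sphereArea n * ENNReal.ofReal (sumProfile n ‖x‖)).map norm := by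
    refine Measure.ext_of_lintegral _ fun φ hφ => ?_
    rw [lintegral_map hφ measurable_norm, lintegral_map hφ measurable_norm,
      lintegral_map (by fun_prop : Measurable fun x : 𝔼 (n + 2) => φ ‖x‖) measurable_sphere_add,
      lintegral_withDensity_eq_lintegral_mul _ hmeas
        (by fun_prop : Measurable fun x : 𝔼 (n + 2) => φ ‖x‖),
      lintegral_prod _ (by fun_prop)]
    simp only [lintegral_norm_add_surfaceMeasure _ hφ, lintegral_const, Pi.mul_apply]
    rw [lintegral_fun_norm_toSphere volume (f := fun r =>
      sphereArea n * ENNReal.ofReal (sumProfile n r) * φ r) (by fun_prop), surfaceMeasure, mul_comm]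
    congr 1
    rw [← lintegral_const_mul _ (by fun_prop), ← Set.Ioi_inter_Iio, Set.inter_comm,
      ← Measure.restrict_restrict measurableSet_Iio, ← lintegral_indicator measurableSet_Iio]
    refine setLIntegral_congr_fun measurableSet_Ioi fun r hr => ?_
    have hr : 0 < r := hr
    by_cases h2 : r < 2
    · simp only [Set.indicator_of_mem (show r ∈ Set.Iio 2 from h2),
        finrank_euclideanSpace, Fintype.card_fin, Nat.add_succ_sub_one]
      rw [ENNReal.ofReal_mul (by positivity)]
      ring
    · rw [Set.indicator_of_notMem (by simpa using h2)]
      simp [sumProfile, h2]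
  -- Finiteness of the explicit density needs no computation: the equality of radial laws already
  -- gives the total mass.
  have hfin : IsFiniteMeasure ((volume : Measure (𝔼 (n + 2))).withDensity
      fun x => sphereArea n * ENNReal.ofReal (sumProfile n ‖x‖)) := by
    constructor
    have := congrArg (fun μ => μ Set.univ) hnorm
    simp only [Measure.map_apply measurable_norm MeasurableSet.univ, Set.preimage_univ] at this
    rw [← this]
    exact measure_lt_top _ _
  refine ext_of_rotationInvariant (fun R => ?_) (fun R => ?_) hnorm
  · rw [Measure.map_map R.continuous.measurable measurable_sphere_add]
    have h1 := (measurePreserving_sphereMap R).prod (measurePreserving_sphereMap R)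
    conv_rhs => rw [← h1.map_eq, Measure.map_map measurable_sphere_add h1.measurable]
    congr 1
    funext p
    simp
  · refine Measure.ext_of_lintegral _ fun φ hφ => ?_
    rw [lintegral_map hφ R.continuous.measurable,
      lintegral_withDensity_eq_lintegral_mul _ hmeas
        (by fun_prop : Measurable fun x : 𝔼 (n + 2) => φ (R x)),
      lintegral_withDensity_eq_lintegral_mul _ hmeas hφ,
      ← R.measurePreserving.lintegral_comp (hmeas.mul hφ)]
    simp

end SumLaw

/-! ### Conditional expectation as an `L²` contraction. -/

section ConditionalExpectation

variable {Ω : Type*} {m m0 : MeasurableSpace Ω} {W : Measure Ω}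

theorem eLpNorm_two_sq {α : Type*} {mα : MeasurableSpace α} {μ : Measure α} {E : Type*}
    [NormedAddCommGroup E] (f : α → E) : eLpNorm f 2 μ ^ 2 = ∫⁻ x, ‖f x‖ₑ ^ 2 ∂μ := by
  have := eLpNorm_nnreal_pow_eq_lintegral (μ := μ) (f := f) (p := 2) two_ne_zero
  simpa using this

theorem eLpNorm_sqrt_smul_sq {k : Ω → ℝ} (hk : ∀ ω, 0 ≤ k ω) (P : Ω → ℂ) :
    eLpNorm (fun ω => √(k ω) • P ω) 2 W ^ 2 = ∫⁻ ω, ENNReal.ofReal (k ω) * ‖P ω‖ₑ ^ 2 ∂W := by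
  rw [eLpNorm_two_sq]
  refine lintegral_congr fun ω => ?_
  rw [enorm_smul, mul_pow, Real.enorm_of_nonneg (Real.sqrt_nonneg _),
    ← ENNReal.ofReal_pow (Real.sqrt_nonneg _), Real.sq_sqrt (hk _)]

theorem eLpNorm_condExp_two_le [IsFiniteMeasure W] (hm : m ≤ m0) {Q : Ω → ℂ} (hQ : MemLp Q 2 W) :
    eLpNorm (W[Q | m]) 2 W ≤ eLpNorm Q 2 W := by
  rw [← eLpNorm_congr_ae (hQ.condExpL2_ae_eq_condExp (𝕜 := ℂ) hm),
    ← eLpNorm_congr_ae hQ.coeFn_toLp]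
  exact eLpNorm_condExpL2_le hm _

/-- An orthogonal projection preserves the norm of a vector only if it fixes the vector. -/
theorem condExp_ae_eq_of_eLpNorm_two_eq [IsFiniteMeasure W] (hm : m ≤ m0) {Q : Ω → ℂ}
    (hQ : MemLp Q 2 W) (h : eLpNorm (W[Q | m]) 2 W = eLpNorm Q 2 W) : W[Q | m] =ᵐ[W] Q := by
  have : Fact (m ≤ m0) := ⟨hm⟩
  rw [← eLpNorm_congr_ae (hQ.condExpL2_ae_eq_condExp (𝕜 := ℂ) hm),
    ← eLpNorm_congr_ae hQ.coeFn_toLp] at h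
  have h1 : ‖(lpMeas ℂ ℂ m 2 W).starProjection (hQ.toLp Q)‖ = ‖hQ.toLp Q‖ := by
    rw [Lp.norm_def, Lp.norm_def]
    exact congrArg ENNReal.toReal h
  have h2 := (Submodule.mem_iff_norm_starProjection _ _).2 h1
  have h3 : (condExpL2 ℂ ℂ hm (hQ.toLp Q) : Lp ℂ 2 W) = hQ.toLp Q :=
    Submodule.starProjection_eq_self_iff.2 h2
  refine (hQ.condExpL2_ae_eq_condExp (𝕜 := ℂ) hm).symm.trans ?_
  rw [h3]
  exact hQ.coeFn_toLp

end ConditionalExpectation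

/-! ### The abstract sharp inequality for push-forwards. -/

section PushforwardFourier

open FourierTransform

variable {Ω : Type*} [MeasurableSpace Ω] {W : Measure Ω}
  {V : Type*} [NormedAddCommGroup V] [InnerProductSpace ℝ V] [FiniteDimensional ℝ V]
  [MeasurableSpace V] [BorelSpace V]

theorem eLpNorm_comp_smul_two_sq (g : V → ℂ) {r : ℝ} (hr : 0 < r) :
    eLpNorm (fun ξ => g (r⁻¹ • ξ)) 2 volume ^ 2 =
      ENNReal.ofReal (r ^ Module.finrank ℝ V) * eLpNorm g 2 volume ^ 2 := by
  have hr' : r⁻¹ ≠ 0 := by positivity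
  have hemb := (Homeomorph.smulOfNeZero (α := V) r⁻¹ hr').measurableEmbedding
  rw [eLpNorm_two_sq, eLpNorm_two_sq]
  have h1 := hemb.lintegral_map (μ := volume) (fun x => ‖g x‖ₑ ^ 2)
  simp only [Homeomorph.smulOfNeZero_apply] at h1
  rw [← h1]
  have h2 := Measure.map_addHaar_smul (volume : Measure V) hr'
  change ∫⁻ a, ‖g a‖ₑ ^ 2 ∂(Measure.map (r⁻¹ • ·) volume) = _
  rw [h2, lintegral_smul_measure, smul_eq_mul]
  congr 2
  rw [inv_pow, inv_inv, abs_of_pos (by positivity)]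

/-- The Fourier transform of the push-forward under `s` of the complex measure `P W`. -/
noncomputable def pushFourier (W : Measure Ω) (s : Ω → V) (P : Ω → ℂ) (ξ : V) : ℂ :=
  ∫ ω, Complex.exp (-Complex.I * ((inner ℝ (s ω) ξ : ℝ) : ℂ)) * P ω ∂W

variable {s : Ω → V} {h : V → ℝ} {P : Ω → ℂ}

theorem norm_exp_neg_I_mul (t : ℝ) : ‖Complex.exp (-Complex.I * (t : ℂ))‖ = 1 := by
  rw [neg_mul, mul_comm, ← neg_mul, ← Complex.ofReal_neg]
  exact Complex.norm_exp_ofReal_mul_I _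

/-- The character is a function of `s`, so it only sees the conditional expectation of `P` given
`s`. -/
theorem pushFourier_condExp [IsFiniteMeasure W] (hs : Measurable s) (hP : Integrable P W) :
    pushFourier W s (W[P | MeasurableSpace.comap s inferInstance]) = pushFourier W s P := by
  funext ξ
  have hm := hs.comap_le
  have hms : Measurable[MeasurableSpace.comap s inferInstance] s := comap_measurable s
  have hexp : StronglyMeasurable[MeasurableSpace.comap s inferInstance]
      fun ω => Complex.exp (-Complex.I * ((inner ℝ (s ω) ξ : ℝ) : ℂ)) :=
    ((by fun_prop : Measurable fun x : V =>
      Complex.exp (-Complex.I * ((inner ℝ x ξ : ℝ) : ℂ))).comp hms).stronglyMeasurable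
  have h1 := condExp_bilin_of_stronglyMeasurable_left (ContinuousLinearMap.mul ℝ ℂ) hexp
    (hP.bdd_mul (c := 1) (hexp.mono hm).aestronglyMeasurable
      (ae_of_all _ fun ω => (norm_exp_neg_I_mul _).le)) hP
  rw [pushFourier, pushFourier]
  refine (integral_congr_ae h1.symm).trans ?_
  exact integral_condExp hm

/-- The scaling by `(2π)⁻¹` converts the character `e^{-i x·ξ}` to the normalization `e^{-2πi x·ξ}`
of `𝓕`; it is the origin of the factor `(2π)^d`. -/
theorem pushFourier_comp (hs : Measurable s) (hh : Measurable h) (hh0 : ∀ x, 0 ≤ h x)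
    (hW : W.map s = volume.withDensity fun x => ENNReal.ofReal (h x)) {F : V → ℂ}
    (hF : StronglyMeasurable F) (ξ : V) :
    pushFourier W s (F ∘ s) ξ = 𝓕 (fun x => h x • F x) ((2 * Real.pi)⁻¹ • ξ) := by
  have hFm := hF.measurable
  rw [pushFourier, Real.fourier_eq']
  have h1 := integral_map (μ := W) hs.aemeasurable (f := fun x : V =>
    Complex.exp (-Complex.I * ((inner ℝ x ξ : ℝ) : ℂ)) * F x) (by fun_prop)
  refine h1.symm.trans ?_
  rw [hW, integral_withDensity_eq_integral_toReal_smul (by fun_prop) (by simp)]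
  refine integral_congr_ae (ae_of_all _ fun x => ?_)
  have h2 : -2 * Real.pi * inner ℝ x ((2 * Real.pi)⁻¹ • ξ) = -inner ℝ x ξ := by
    rw [inner_smul_right]
    field_simp
  simp only [h2, ENNReal.toReal_ofReal (hh0 x), Complex.real_smul, smul_eq_mul]
  rw [show -Complex.I * ((inner ℝ x ξ : ℝ) : ℂ) = ((-inner ℝ x ξ : ℝ) : ℂ) * Complex.I by
    push_cast; ring]
  ring

theorem lintegral_enorm_smul_sq_eq (hs : Measurable s) (hh : Measurable h) (hh0 : ∀ x, 0 ≤ h x)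
    (hW : W.map s = volume.withDensity fun x => ENNReal.ofReal (h x)) {F : V → ℂ}
    (hF : StronglyMeasurable F) :
    eLpNorm (fun x => h x • F x) 2 volume ^ 2 =
      ∫⁻ ω, ENNReal.ofReal (h (s ω)) * ‖F (s ω)‖ₑ ^ 2 ∂W := by
  have hFm := hF.measurable
  have h1 := lintegral_map (μ := W) (f := fun x => ENNReal.ofReal (h x) * ‖F x‖ₑ ^ 2)
    (by fun_prop) hs
  rw [← h1, hW, lintegral_withDensity_eq_lintegral_mul _ (by fun_prop) (by fun_prop),
    eLpNorm_two_sq]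
  refine lintegral_congr fun x => ?_
  simp only [enorm_smul, Pi.mul_apply, Real.enorm_of_nonneg (hh0 x)]
  ring

theorem ae_pos_comp (hs : Measurable s) (hh : Measurable h)
    (hW : W.map s = volume.withDensity fun x => ENNReal.ofReal (h x)) :
    ∀ᵐ ω ∂W, 0 < h (s ω) := by
  refine ae_of_ae_map hs.aemeasurable (p := fun x => 0 < h x) ?_
  rw [hW, ae_withDensity_iff (by fun_prop)]
  exact ae_of_all _ fun x hx => by simpa using hx

/-- If `s` pushes `W` to the density `h`, then the `L²` norm of the Fourier transform of the
push-forward of `P W` is bounded by the `h ∘ s`-weighted `L²` norm of `P`; equality holds exactly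
if `P` is a function of `s`. -/
theorem eLpNorm_pushFourier [IsFiniteMeasure W] (hs : Measurable s) (hh : Measurable h)
    (hh0 : ∀ x, 0 ≤ h x)
    (hW : W.map s = volume.withDensity fun x => ENNReal.ofReal (h x))
    (hP : Integrable P W) (hfin : ∫⁻ ω, ENNReal.ofReal (h (s ω)) * ‖P ω‖ₑ ^ 2 ∂W < ∞) :
    eLpNorm (pushFourier W s P) 2 volume ^ 2 ≤
      ENNReal.ofReal ((2 * Real.pi) ^ Module.finrank ℝ V) *
        ∫⁻ ω, ENNReal.ofReal (h (s ω)) * ‖P ω‖ₑ ^ 2 ∂W ∧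
    (eLpNorm (pushFourier W s P) 2 volume ^ 2 =
      ENNReal.ofReal ((2 * Real.pi) ^ Module.finrank ℝ V) *
        ∫⁻ ω, ENNReal.ofReal (h (s ω)) * ‖P ω‖ₑ ^ 2 ∂W ↔
      AEStronglyMeasurable[MeasurableSpace.comap s inferInstance] P W) := by
  have hm := hs.comap_le
  have hms : Measurable[MeasurableSpace.comap s inferInstance] s := comap_measurable s
  have hsq : StronglyMeasurable[MeasurableSpace.comap s inferInstance] fun ω => √(h (s ω)) :=
    ((by fun_prop : Measurable fun x : V => √(h x)).comp hms).stronglyMeasurable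
  have hQ : MemLp (fun ω => √(h (s ω)) • P ω) 2 W := by
    refine ⟨(hsq.mono hm).aestronglyMeasurable.smul hP.1, ?_⟩
    rw [← eLpNorm_sqrt_smul_sq fun ω => hh0 (s ω)] at hfin
    exact (ENNReal.pow_lt_top_iff.1 hfin).resolve_right two_ne_zero
  have hcond : W[fun ω => √(h (s ω)) • P ω | MeasurableSpace.comap s inferInstance] =ᵐ[W]
      fun ω => √(h (s ω)) • W[P | MeasurableSpace.comap s inferInstance] ω :=
    condExp_smul_of_aestronglyMeasurable_left hsq.aestronglyMeasurable
      (hQ.integrable one_le_two) hP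
  -- The conditional expectation factors as `F ∘ s`, so the push-forward of `P W` has Lebesgue
  -- density `h F`.
  obtain ⟨F, hF, hFK⟩ := (stronglyMeasurable_condExp (μ := W)
    (m := MeasurableSpace.comap s inferInstance) (f := P)).exists_eq_measurable_comp
  have hK : ∫⁻ ω, ENNReal.ofReal (h (s ω)) *
        ‖W[P | MeasurableSpace.comap s inferInstance] ω‖ₑ ^ 2 ∂W =
      eLpNorm (W[fun ω => √(h (s ω)) • P ω | MeasurableSpace.comap s inferInstance]) 2 W ^ 2 := by
    rw [eLpNorm_congr_ae hcond, eLpNorm_sqrt_smul_sq fun ω => hh0 (s ω)]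
  have hle := eLpNorm_condExp_two_le hm hQ
  have hL2 : eLpNorm (fun x => h x • F x) 2 volume ^ 2 =
      eLpNorm (W[fun ω => √(h (s ω)) • P ω | MeasurableSpace.comap s inferInstance]) 2 W ^ 2 := by
    rw [lintegral_enorm_smul_sq_eq hs hh hh0 hW hF, ← hK, hFK]
    rfl
  have hFm := hF.measurable
  have hmem : MemLp (fun x => h x • F x) 2 (volume : Measure V) := by
    refine ⟨by fun_prop, ?_⟩
    have : eLpNorm (fun x => h x • F x) 2 (volume : Measure V) ^ 2 < ∞ := by
      rw [hL2]
      exact ENNReal.pow_lt_top (hle.trans_lt hQ.2)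
    exact (ENNReal.pow_lt_top_iff.1 this).resolve_right two_ne_zero
  have hInt : Integrable (fun x => h x • F x) (volume : Measure V) := by
    have h1 : Integrable (F ∘ s) W := hFK ▸ integrable_condExp
    have h2 := (integrable_map_measure hF.aestronglyMeasurable hs.aemeasurable).2 h1
    rw [hW, integrable_withDensity_iff_integrable_smul₀' (by fun_prop) (by simp)] at h2
    refine h2.congr (ae_of_all _ fun x => ?_)
    simp only [ENNReal.toReal_ofReal (hh0 x)]
  have hmain : eLpNorm (pushFourier W s P) 2 volume ^ 2 =
      ENNReal.ofReal ((2 * Real.pi) ^ Module.finrank ℝ V) *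
        eLpNorm (W[fun ω => √(h (s ω)) • P ω | MeasurableSpace.comap s inferInstance]) 2 W ^ 2 := by
    rw [← pushFourier_condExp hs hP, hFK, ← hL2, ← eLpNorm_fourier_eq hInt hmem,
      ← eLpNorm_comp_smul_two_sq _ Real.two_pi_pos]
    congr 2
    exact funext fun ξ => pushFourier_comp hs hh hh0 hW hF ξ
  have hc0 : ENNReal.ofReal ((2 * Real.pi) ^ Module.finrank ℝ V) ≠ 0 :=
    (ENNReal.ofReal_pos.2 (by positivity)).ne'
  rw [hmain, ← eLpNorm_sqrt_smul_sq fun ω => hh0 (s ω)]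
  refine ⟨by gcongr, ?_⟩
  rw [ENNReal.mul_right_inj hc0 ENNReal.ofReal_ne_top]
  constructor
  · intro heq
    have h1 := condExp_ae_eq_of_eLpNorm_two_eq hm hQ
      ((ENNReal.pow_right_strictMono two_ne_zero).injective heq)
    refine (stronglyMeasurable_condExp (μ := W) (m := MeasurableSpace.comap s inferInstance)
      (f := P)).aestronglyMeasurable.congr ?_
    -- Equality in the contraction fixes `√h(s) P`; as `h(s) > 0` almost everywhere, the weight
    -- cancels.
    filter_upwards [h1, hcond, ae_pos_comp hs hh hW] with ω h1 h2 h3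
    rw [h2] at h1
    exact smul_right_injective ℂ (Real.sqrt_pos.2 h3).ne' h1
  · intro hPm
    have h1 := condExp_of_aestronglyMeasurable' hm hPm hP
    rw [eLpNorm_congr_ae hcond]
    congr 1
    refine eLpNorm_congr_ae ?_
    filter_upwards [h1] with ω hω
    rw [hω]

end PushforwardFourier

/-! ### The sharp bilinear inequality on the sphere. -/

section Sphere

variable {n : ℕ}

local notation "𝔼" d => EuclideanSpace ℝ (Fin d)

theorem sumProfile_nonneg (n : ℕ) (r : ℝ) : 0 ≤ sumProfile n r := by
  refine Set.indicator_nonneg (fun r hr => ?_) r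
  have : 0 ≤ 1 - r ^ 2 / 4 := by nlinarith [hr.1, hr.2]
  exact mul_nonneg (inv_nonneg.2 hr.1.le) (Real.rpow_nonneg this _)

/-- The density of `σ ∗ σ` on `ℝ^{n+2}`. -/
noncomputable def sumDensity (n : ℕ) (x : 𝔼 (n + 2)) : ℝ :=
  (sphereArea n).toReal * sumProfile n ‖x‖

theorem measurable_sumDensity (n : ℕ) : Measurable (sumDensity n) := by
  have := measurable_sumProfile n
  unfold sumDensity
  fun_prop

theorem sumDensity_nonneg (n : ℕ) (x : 𝔼 (n + 2)) : 0 ≤ sumDensity n x :=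
  mul_nonneg ENNReal.toReal_nonneg (sumProfile_nonneg _ _)

theorem sphereArea_ne_top (n : ℕ) : sphereArea n ≠ ∞ := measure_ne_top _ _

theorem ofReal_sumDensity (n : ℕ) (x : 𝔼 (n + 2)) :
    ENNReal.ofReal (sumDensity n x) = sphereArea n * ENNReal.ofReal (sumProfile n ‖x‖) := by
  rw [sumDensity, ENNReal.ofReal_mul ENNReal.toReal_nonneg, ENNReal.ofReal_toReal]
  exact sphereArea_ne_top n

/-- The sum of two points of the sphere. -/
noncomputable def sphereAdd (d : ℕ) (p : USphere d × USphere d) : 𝔼 d := (p.1 : 𝔼 d) + p.2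

theorem measurable_sphereAdd (d : ℕ) : Measurable (sphereAdd d) := measurable_sphere_add

theorem map_sphereAdd (n : ℕ) :
    ((surfaceMeasure (n + 2)).prod (surfaceMeasure (n + 2))).map (sphereAdd (n + 2)) =
    (volume : Measure (𝔼 (n + 2))).withDensity fun x => ENNReal.ofReal (sumDensity n x) := by
  simp only [ofReal_sumDensity]
  exact map_add_prod_surfaceMeasure n

/-- With `t = ζ₁·ζ₂` and `r = ‖ζ₁ + ζ₂‖`, one has `r² = 2(1 + t)` and `1 - r² / 4 = (1 - t) / 2`.
Collecting the powers of two gives `2^{-1/2 - (n-1)/2} = 2^{(2-d)/2}` for `d = n + 2`. -/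
theorem sumProfile_eq_weightKernel {p : USphere (n + 2) × USphere (n + 2)}
    (hp : ‖sphereAdd (n + 2) p‖ ∈ Set.Ioo (0 : ℝ) 2) :
    ENNReal.ofReal (sumProfile n ‖sphereAdd (n + 2) p‖) =
      ENNReal.ofReal ((2 : ℝ) ^ ((2 - ((n + 2 : ℕ) : ℝ)) / 2)) * weightKernel (n + 2) p.1 p.2 := by
  rw [sumProfile, Set.indicator_of_mem hp, weightKernel]
  set t : ℝ := inner ℝ (p.1 : 𝔼 (n + 2)) (p.2 : 𝔼 (n + 2)) with ht
  set r : ℝ := ‖sphereAdd (n + 2) p‖ with hr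
  have hr2 : r ^ 2 = 2 + 2 * t := by
    rw [hr, sphereAdd, norm_add_sq_real]
    simp only [norm_eq_of_mem_sphere]
    ring
  have h1 : 0 < 1 + t := by nlinarith [hp.1]
  have h2 : 0 < 1 - t := by nlinarith [hp.1, hp.2]
  have hr' : r = (2 * (1 + t)) ^ (1 / 2 : ℝ) := by
    rw [← Real.sqrt_eq_rpow, ← mul_one 2, mul_assoc, one_mul, mul_add, mul_one, ← hr2,
      Real.sqrt_sq (norm_nonneg _)]
  rw [ENNReal.ofReal_rpow_of_pos h2, ← ENNReal.ofReal_div_of_pos h1,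
    ENNReal.ofReal_rpow_of_pos (by positivity), ← ENNReal.ofReal_mul (by positivity)]
  congr 1
  rw [hr2, show 1 - (2 + 2 * t) / 4 = (1 - t) * 2⁻¹ by ring, hr',
    Real.mul_rpow zero_le_two h1.le, Real.mul_rpow h2.le (by norm_num),
    Real.div_rpow (by positivity) h1.le, ← Real.rpow_mul h2.le, Real.inv_rpow zero_le_two]
  have e1 : (((n + 2 : ℕ) : ℝ) - 3) * (1 / 2) = ((n : ℝ) - 1) / 2 := by push_cast; ring
  have e2 : (2 : ℝ) ^ ((2 - ((n + 2 : ℕ) : ℝ)) / 2) =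
      ((2 : ℝ) ^ (1 / 2 : ℝ))⁻¹ * ((2 : ℝ) ^ (((n : ℝ) - 1) / 2))⁻¹ := by
    rw [← Real.rpow_neg zero_le_two, ← Real.rpow_neg zero_le_two, ← Real.rpow_add zero_lt_two]
    congr 1
    push_cast
    ring
  rw [e1, e2, mul_inv]
  ring

theorem weightedSide_eq (f₁ f₂ : USphere (n + 2) → ℂ) :
    weightedSide (n + 2) f₁ f₂ = ENNReal.ofReal ((2 * Real.pi) ^ Module.finrank ℝ (𝔼 (n + 2))) *
      ∫⁻ p, ENNReal.ofReal (sumDensity n (sphereAdd (n + 2) p)) * ‖f₁ p.1 * f₂ p.2‖ₑ ^ 2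
        ∂((surfaceMeasure (n + 2)).prod (surfaceMeasure (n + 2))) := by
  rw [weightedSide, ENNReal.ofReal_mul (by positivity), finrank_euclideanSpace, Fintype.card_fin,
    mul_assoc, mul_assoc]
  congr 1
  rw [← lintegral_const_mul' _ _ (sphereArea_ne_top _),
    ← lintegral_const_mul' _ _ ENNReal.ofReal_ne_top]
  refine lintegral_congr_ae ?_
  filter_upwards [ae_pos_comp (measurable_sphereAdd _) (measurable_sumDensity n)
    (map_sphereAdd n)] with p hp
  -- Positivity of the density, which holds almost everywhere, excludes the endpoints `0` and `2`.
  have hmem : ‖sphereAdd (n + 2) p‖ ∈ Set.Ioo (0 : ℝ) 2 := by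
    by_contra hn
    simp [sumDensity, sumProfile, Set.indicator_of_notMem hn] at hp
  rw [ofReal_sumDensity, sumProfile_eq_weightKernel hmem, enorm_mul, mul_pow, Nat.add_sub_cancel]
  ring

theorem integrable_tensor {d : ℕ} {f₁ f₂ : USphere d → ℂ} (hf₁ : Integrable f₁ (surfaceMeasure d))
    (hf₂ : Integrable f₂ (surfaceMeasure d)) :
    Integrable (fun p : USphere d × USphere d => f₁ p.1 * f₂ p.2)
      ((surfaceMeasure d).prod (surfaceMeasure d)) := hf₁.mul_prod hf₂

theorem bilinearExtensionNormSq_eq {d : ℕ} (f₁ f₂ : USphere d → ℂ) :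
    bilinearExtensionNormSq d f₁ f₂ = eLpNorm (pushFourier
      ((surfaceMeasure d).prod (surfaceMeasure d)) (sphereAdd d) fun p => f₁ p.1 * f₂ p.2)
      2 volume ^ 2 := by
  rw [bilinearExtensionNormSq]
  congr 2
  funext ξ
  rw [extensionFourier, extensionFourier, pushFourier, ← integral_prod_mul]
  refine integral_congr_ae (ae_of_all _ fun p => ?_)
  simp only [sphereAdd, inner_add_left, Complex.ofReal_add, mul_add, Complex.exp_add]
  ring

/-- The sharp bilinear inequality and its case of equality, in terms of the dependence of
`f₁ ⊗ f₂` on the sum of the variables. -/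
theorem bilinearExtensionNormSq_le {d : ℕ} (hd : 2 ≤ d) {f₁ f₂ : USphere d → ℂ}
    (hf₁ : Integrable f₁ (surfaceMeasure d)) (hf₂ : Integrable f₂ (surfaceMeasure d)) :
    bilinearExtensionNormSq d f₁ f₂ ≤ weightedSide d f₁ f₂ ∧
    (weightedSide d f₁ f₂ < ∞ →
      (bilinearExtensionNormSq d f₁ f₂ = weightedSide d f₁ f₂ ↔
        AEStronglyMeasurable[MeasurableSpace.comap (sphereAdd d) inferInstance]
          (fun p => f₁ p.1 * f₂ p.2) ((surfaceMeasure d).prod (surfaceMeasure d)))) := by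
  obtain ⟨n, rfl⟩ : ∃ n, d = n + 2 := ⟨d - 2, by omega⟩
  rcases eq_or_ne (weightedSide (n + 2) f₁ f₂) ∞ with htop | htop
  · simp [htop]
  rw [bilinearExtensionNormSq_eq, weightedSide_eq]
  rw [weightedSide_eq] at htop
  have hfin := ENNReal.lt_top_of_mul_ne_top_right htop
    (ENNReal.ofReal_pos.2 (by positivity)).ne'
  have := eLpNorm_pushFourier (measurable_sphereAdd _) (measurable_sumDensity n)
    (sumDensity_nonneg n) (map_sphereAdd n) (integrable_tensor hf₁ hf₂) hfin
  exact ⟨this.1, fun _ => this.2⟩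

end Sphere

/-! ### The Fourier–Laplace transform at complex frequencies. -/

section Laplace

variable {d : ℕ}

local notation "𝔼" d => EuclideanSpace ℝ (Fin d)

/-- The bilinear pairing `μ · x` of a complex with a real vector. -/
noncomputable def cdot (μ : Fin d → ℂ) (x : 𝔼 d) : ℂ := ∑ i, μ i * ((x i : ℝ) : ℂ)

/-- The linear form on `ℂ^d` with given coefficients. -/
noncomputable def coeffForm (u : Fin d → ℂ) : (Fin d → ℂ) →L[ℂ] ℂ :=
  ∑ i, u i • ContinuousLinearMap.proj (R := ℂ) (φ := fun _ => ℂ) i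

theorem coeffForm_apply (u h : Fin d → ℂ) : coeffForm u h = ∑ i, u i * h i := by
  simp [coeffForm]

/-- `cdot` as a continuous linear form of its complex argument. -/
noncomputable def cdotCLM (x : 𝔼 d) : (Fin d → ℂ) →L[ℂ] ℂ :=
  coeffForm fun i => ((x i : ℝ) : ℂ)

theorem cdotCLM_apply (x : 𝔼 d) (μ : Fin d → ℂ) : cdotCLM x μ = cdot μ x := by
  simp [cdotCLM, cdot, coeffForm_apply, mul_comm]

theorem continuous_cdotCLM : Continuous (cdotCLM (d := d)) := by
  unfold cdotCLM coeffForm; fun_prop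

@[fun_prop]
theorem Continuous.cdot {X : Type*} [TopologicalSpace X] {μ : X → Fin d → ℂ} {x : X → 𝔼 d}
    (hμ : Continuous μ) (hx : Continuous x) : Continuous fun t => cdot (μ t) (x t) := by
  unfold _root_.cdot; fun_prop

theorem cdot_add_left (μ ν : Fin d → ℂ) (x : 𝔼 d) : cdot (μ + ν) x = cdot μ x + cdot ν x := by
  simp [cdot, add_mul, Finset.sum_add_distrib]

theorem cdot_add_right (μ : Fin d → ℂ) (x y : 𝔼 d) : cdot μ (x + y) = cdot μ x + cdot μ y := by
  simp [cdot, mul_add, Finset.sum_add_distrib]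

/-- The purely imaginary frequency `i ξ`. -/
noncomputable def imFreq (ξ : 𝔼 d) : Fin d → ℂ := fun j => Complex.I * ((ξ j : ℝ) : ℂ)

theorem cdot_imFreq (ξ x : 𝔼 d) : cdot (imFreq ξ) x = ((inner ℝ x ξ : ℝ) : ℂ) * Complex.I := by
  simp only [cdot, imFreq, PiLp.inner_apply, RCLike.inner_apply, conj_trivial, Complex.ofReal_sum,
    Complex.ofReal_mul, Finset.sum_mul]
  exact Finset.sum_congr rfl fun i _ => by ring

theorem integrable_mul_continuous {f g : USphere d → ℂ} (hf : Integrable f (surfaceMeasure d))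
    (hg : Continuous g) : Integrable (fun ζ => f ζ * g ζ) (surfaceMeasure d) := by
  obtain ⟨C, hC⟩ := isCompact_univ.exists_bound_of_continuousOn hg.continuousOn
  exact hf.mul_bdd hg.aestronglyMeasurable (ae_of_all _ fun ζ => hC ζ (Set.mem_univ _))

/-- The Fourier–Laplace transform `μ ↦ ∫ f(ζ) e^{μ·ζ} dσ(ζ)`. -/
noncomputable def laplace (f : USphere d → ℂ) (μ : Fin d → ℂ) : ℂ :=
  ∫ ζ : USphere d, f ζ * Complex.exp (cdot μ (ζ : 𝔼 d)) ∂(surfaceMeasure d)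

/-- The gradient of the Fourier–Laplace transform. -/
noncomputable def laplaceGrad (f : USphere d → ℂ) (μ : Fin d → ℂ) (i : Fin d) : ℂ :=
  ∫ ζ : USphere d, f ζ * ((((ζ : 𝔼 d) i : ℝ) : ℂ) * Complex.exp (cdot μ (ζ : 𝔼 d)))
    ∂(surfaceMeasure d)

theorem norm_coe_sphere_le (ζ : USphere d) (i : Fin d) : ‖(((ζ : 𝔼 d) i : ℝ) : ℂ)‖ ≤ 1 := by
  rw [Complex.norm_real]
  exact (PiLp.norm_apply_le _ i).trans (norm_eq_of_mem_sphere ζ).le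

theorem norm_exp_cdot_le (μ : Fin d → ℂ) (ζ : USphere d) :
    ‖Complex.exp (cdot μ (ζ : 𝔼 d))‖ ≤ Real.exp (d * ‖μ‖) := by
  refine (Complex.norm_exp_le_exp_norm _).trans (Real.exp_le_exp.2 ?_)
  refine (norm_sum_le _ _).trans ?_
  have : ∀ i ∈ Finset.univ, ‖μ i * (((ζ : 𝔼 d) i : ℝ) : ℂ)‖ ≤ ‖μ‖ := by
    intro i _
    rw [norm_mul]
    exact (mul_le_of_le_one_right (norm_nonneg _) (norm_coe_sphere_le ζ i)).trans
      (norm_le_pi_norm _ i)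
  simpa using Finset.sum_le_sum this

theorem hasFDerivAt_laplace {f : USphere d → ℂ} (hf : Integrable f (surfaceMeasure d))
    (μ : Fin d → ℂ) :
    HasFDerivAt (laplace f) (coeffForm (laplaceGrad f μ)) μ := by
  have hb : ∃ C, ∀ ζ : USphere d, ‖cdotCLM (ζ : 𝔼 d)‖ ≤ C := by
    obtain ⟨C, hC⟩ := isCompact_univ.exists_bound_of_continuousOn
      (continuous_cdotCLM.comp
        (continuous_subtype_val (p := (· ∈ Metric.sphere (0 : 𝔼 d) 1)))).continuousOn
    exact ⟨C, fun ζ => hC ζ (Set.mem_univ _)⟩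
  obtain ⟨C, hC⟩ := hb
  have hm : AEStronglyMeasurable (fun ζ : USphere d =>
      f ζ • (Complex.exp (cdot μ (ζ : 𝔼 d)) • cdotCLM (ζ : 𝔼 d))) (surfaceMeasure d) := by
    have h1 : Continuous fun ζ : USphere d => Complex.exp (cdot μ (ζ : 𝔼 d)) := by fun_prop
    have h2 : Continuous fun ζ : USphere d => cdotCLM (ζ : 𝔼 d) :=
      continuous_cdotCLM.comp continuous_subtype_val
    exact hf.1.smul (h1.smul h2).aestronglyMeasurable
  have h1 := hasFDerivAt_integral_of_dominated_of_fderiv_le (𝕜 := ℂ) (μ := surfaceMeasure d)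
    (F := fun (μ : Fin d → ℂ) (ζ : USphere d) => f ζ * Complex.exp (cdot μ (ζ : 𝔼 d)))
    (F' := fun (μ : Fin d → ℂ) (ζ : USphere d) =>
      f ζ • (Complex.exp (cdot μ (ζ : 𝔼 d)) • cdotCLM (ζ : 𝔼 d)))
    (x₀ := μ) (s := Metric.ball μ 1) (bound := fun ζ => ‖f ζ‖ * (Real.exp (d * (‖μ‖ + 1)) * C))
    (Metric.ball_mem_nhds _ one_pos)
    (Filter.Eventually.of_forall fun μ => (integrable_mul_continuous hf (by fun_prop)).1)
    (integrable_mul_continuous hf (by fun_prop))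
    hm (ae_of_all _ fun ζ μ' hμ' => ?_) (hf.norm.mul_const _) (ae_of_all _ fun ζ μ' _ => ?_)
  · refine h1.congr_fderiv ?_
    ext h
    rw [ContinuousLinearMap.integral_apply]
    · simp only [smul_apply, cdotCLM_apply, smul_eq_mul,
        coeffForm_apply, laplaceGrad,
        ← integral_mul_const]
      rw [← integral_finsetSum _ fun i _ =>
        (integrable_mul_continuous hf (by fun_prop)).mul_const _]
      refine integral_congr_ae (ae_of_all _ fun ζ => ?_)
      simp only [cdot, Finset.mul_sum]
      exact Finset.sum_congr rfl fun i _ => by ring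
    · refine Integrable.mono' (hf.norm.mul_const (Real.exp (d * ‖μ‖) * C)) hm
        (ae_of_all _ fun ζ => ?_)
      rw [norm_smul, norm_smul]
      gcongr
      · exact norm_exp_cdot_le _ _
      · exact hC ζ
  · rw [norm_smul, norm_smul]
    have hμ'' : ‖μ'‖ ≤ ‖μ‖ + 1 := by
      have := norm_sub_norm_le μ' μ
      have h2 : ‖μ' - μ‖ < 1 := by simpa [dist_eq_norm] using hμ'
      linarith
    gcongr
    · exact (norm_exp_cdot_le _ _).trans (by gcongr)
    · exact hC ζ
  · have h2 : HasFDerivAt (fun μ : Fin d → ℂ => cdot μ (ζ : 𝔼 d)) (cdotCLM (ζ : 𝔼 d)) μ' := by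
      refine (cdotCLM (ζ : 𝔼 d)).hasFDerivAt.congr_of_eventuallyEq ?_
      exact Filter.Eventually.of_forall fun μ => (cdotCLM_apply _ _).symm
    exact (h2.cexp).const_smul (f ζ)

theorem reflection_orthogonal_singleton_apply {v : 𝔼 d} (hv : ‖v‖ = 1) (x : 𝔼 d) :
    (ℝ ∙ v)ᗮ.reflection x = x - (2 * inner ℝ v x) • v := by
  rw [Submodule.reflection_orthogonal_apply, Submodule.reflection_apply,
    Submodule.starProjection_singleton]
  simp [hv, mul_smul, two_smul]

/-- A real reflection preserves `σ` and is symmetric for the bilinear pairing, so it can be moved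
onto the complex frequency. -/
theorem laplace_one_reflect (μ : Fin d → ℂ) {v : 𝔼 d} (hv : ‖v‖ = 1) :
    laplace 1 (fun i => μ i - 2 * cdot μ v * ((v i : ℝ) : ℂ)) = laplace 1 μ := by
  unfold laplace
  rw [← integral_comp_sphereMap (ℝ ∙ v)ᗮ.reflection fun ζ : USphere d =>
    (1 : USphere d → ℂ) ζ * Complex.exp (cdot μ (ζ : 𝔼 d))]
  refine integral_congr_ae (ae_of_all _ fun ζ => ?_)
  simp only [coe_sphereMap, reflection_orthogonal_singleton_apply hv, Pi.one_apply, one_mul]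
  congr 1
  simp only [cdot, PiLp.sub_apply, PiLp.smul_apply, smul_eq_mul, Complex.ofReal_sub,
    Complex.ofReal_mul, sub_mul, mul_sub, Finset.sum_sub_distrib]
  congr 1
  simp only [PiLp.inner_apply, RCLike.inner_apply, conj_trivial, Complex.ofReal_sum,
    Complex.ofReal_mul, Complex.ofReal_ofNat, Finset.sum_mul, Finset.mul_sum]
  rw [Finset.sum_comm]
  exact Finset.sum_congr rfl fun i _ => Finset.sum_congr rfl fun j _ => by ring

/-- The gradient of the Fourier–Laplace transform of the surface measure is radial. -/
theorem laplaceGrad_one_radial (m : Fin d → ℂ) (b c : Fin d) :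
    laplaceGrad 1 m b * m c = laplaceGrad 1 m c * m b := by
  rcases eq_or_ne b c with rfl | hbc
  · rfl
  -- `μ` is `m` reflected in `e_b`. Reflecting it back along `v t`, which turns from `e_b` towards
  -- `e_c`, gives a curve `w` through `m` at `t = 0` on which the transform is constant; its
  -- velocity there is `2 (m_b e_c - m_c e_b)`.
  let μ : Fin d → ℂ := fun i => m i - if i = b then 2 * m b else 0
  have hμb : μ b = -m b := by simp [μ]; ring
  have hμc : μ c = m c := by simp [μ, hbc.symm]
  let v : ℝ → 𝔼 d := fun t =>
    EuclideanSpace.single b (Real.cos t) + EuclideanSpace.single c (Real.sin t)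
  have hv : ∀ t, ‖v t‖ = 1 := by
    intro t
    have : ‖v t‖ ^ 2 = 1 := by
      rw [norm_add_sq_real]
      simp [EuclideanSpace.inner_single_left, hbc, Real.cos_sq_add_sin_sq]
    exact (pow_eq_one_iff_of_nonneg (norm_nonneg _) two_ne_zero).1 this
  have hcd : ∀ t, cdot μ (v t) = -m b * Complex.cos t + m c * Complex.sin t := by
    intro t
    rw [cdot_add_right]
    simp [cdot, hμb, hμc, apply_ite, PiLp.single_apply]
  let w : ℝ → Fin d → ℂ := fun t i => μ i - 2 * cdot μ (v t) * ((v t i : ℝ) : ℂ)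
  have hconst : ∀ t, laplace 1 (w t) = laplace 1 μ := fun t => laplace_one_reflect μ (hv t)
  have hw0 : w 0 = m := by
    funext i
    by_cases hi : i = b
    · subst hi; simp [w, hcd, μ, v, hbc]
    · simp [w, hcd, μ, v, hi]
  have hw' : HasDerivAt w (fun i => (if i = b then -2 * m c else 0) +
      (if i = c then 2 * m b else 0)) 0 := by
    rw [hasDerivAt_pi]
    intro i
    have hcos : HasDerivAt (fun t : ℝ => Complex.cos t) (-Complex.sin ((0 : ℝ) : ℂ)) (0 : ℝ) :=
      (Complex.hasDerivAt_cos _).comp_ofReal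
    have hsin : HasDerivAt (fun t : ℝ => Complex.sin t) (Complex.cos ((0 : ℝ) : ℂ)) (0 : ℝ) :=
      (Complex.hasDerivAt_sin _).comp_ofReal
    have h1 := (((hcos.const_mul (-m b)).add (hsin.const_mul (m c))).const_mul 2).mul
      ((hcos.const_mul (if i = b then 1 else 0)).add (hsin.const_mul (if i = c then 1 else 0)))
    have h2 := h1.const_sub (μ i)
    have h3 : (fun t => w t i) = fun t : ℝ =>
        μ i - 2 * (-m b * Complex.cos t + m c * Complex.sin t) *
        ((if i = b then 1 else 0) * Complex.cos t + (if i = c then 1 else 0) * Complex.sin t) := by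
      funext t
      simp only [w, hcd]
      congr 2
      by_cases hb : i = b <;> by_cases hc : i = c <;> simp [v, hb, hc, hbc, hbc.symm]
    rw [h3]
    refine h2.congr_deriv ?_
    by_cases hb : i = b
    · simp [hb, hbc]
    · by_cases hc : i = c <;> simp [hb, hc, hbc.symm]
  have hd := ((hasFDerivAt_laplace (f := 1) (integrable_const (1 : ℂ))
    (w 0)).restrictScalars ℝ).comp_hasDerivAt (0 : ℝ) hw'
  have hd0 := hd.unique ((hasDerivAt_const (0 : ℝ) (laplace 1 μ)).congr_of_eventuallyEq
    (Filter.Eventually.of_forall hconst))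
  rw [hw0] at hd0
  simp only [ContinuousLinearMap.coe_restrictScalars', coeffForm_apply, mul_add,
    Finset.sum_add_distrib, mul_ite, mul_zero, Finset.sum_ite_eq', Finset.mem_univ, if_true] at hd0
  linear_combination (-1 / 2 : ℂ) * hd0

end Laplace

/-! ### Pairwise coplanar lines in complex space. -/

section LinearAlgebra

variable {ι : Type*}

/-- The `3 × 3` minor of three vectors. -/
def minor₃ (x y z : ι → ℂ) (a b c : ι) : ℂ :=
  z c * (x a * y b - x b * y a) + z b * (x c * y a - x a * y c) + z a * (x b * y c - x c * y b)

theorem exists_minor_ne_zero {x y : ι → ℂ} (h : LinearIndependent ℂ ![x, y]) :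
    ∃ b c, x b * y c - x c * y b ≠ 0 := by
  by_contra! hn
  rw [LinearIndependent.pair_iff] at h
  have hx : x = 0 := by
    funext b
    have := (h (y b) (-x b) (by
      funext c
      simp only [Pi.add_apply, Pi.smul_apply, smul_eq_mul, Pi.zero_apply]
      linear_combination -hn b c)).2
    simpa using this
  have := (h 1 0 (by simp [hx])).1
  simp at this

theorem exists_eq_of_minor₃_eq_zero {x y z : ι → ℂ} (h : LinearIndependent ℂ ![x, y])
    (h3 : ∀ a b c, minor₃ x y z a b c = 0) : ∃ α β : ℂ, z = α • x + β • y := by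
  obtain ⟨b, c, hD⟩ := exists_minor_ne_zero h
  refine ⟨(z b * y c - z c * y b) / (x b * y c - x c * y b),
    (z c * x b - z b * x c) / (x b * y c - x c * y b), ?_⟩
  funext a
  have := h3 a b c
  simp only [minor₃] at this
  simp only [Pi.add_apply, Pi.smul_apply, smul_eq_mul]
  rw [div_mul_eq_mul_div, div_mul_eq_mul_div, ← add_div, eq_div_iff hD]
  linear_combination this

theorem linearIndependent_pair_of_minor_ne_zero {x y : ι → ℂ} {b c : ι}
    (h : x b * y c - x c * y b ≠ 0) : LinearIndependent ℂ ![x, y] := by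
  rw [LinearIndependent.pair_iff]
  intro s t hst
  have hb := congrFun hst b
  have hc := congrFun hst c
  simp only [Pi.add_apply, Pi.smul_apply, smul_eq_mul, Pi.zero_apply] at hb hc
  refine ⟨(mul_eq_zero.1 ?_).resolve_right h, (mul_eq_zero.1 ?_).resolve_right h⟩
  · linear_combination y c * hb - y b * hc
  · linear_combination x b * hc - x c * hb

theorem not_linearIndependent_of_mem_span_pair [Fintype ι] {x y u v w : ι → ℂ}
    (hu : u ∈ Submodule.span ℂ {x, y}) (hv : v ∈ Submodule.span ℂ {x, y})
    (hw : w ∈ Submodule.span ℂ {x, y}) : ¬ LinearIndependent ℂ ![u, v, w] := by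
  intro h
  have h1 := finrank_span_eq_card h
  have h2 : Submodule.span ℂ (Set.range ![u, v, w]) ≤ Submodule.span ℂ {x, y} := by
    rw [Submodule.span_le]
    rintro _ ⟨i, rfl⟩
    fin_cases i
    exacts [hu, hv, hw]
  have h3 := Submodule.finrank_mono h2
  have h4 : Module.finrank ℂ (Submodule.span ℂ ({x, y} : Set (ι → ℂ))) ≤ 2 := by
    classical
    exact (finrank_span_le_card _).trans (by simpa using Finset.card_le_two)
  rw [h1] at h3
  simp at h3
  omega

/-- If any two of the lines `μ + ℂ U(μ)` are coplanar, and there are three linearly independent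
directions, then all the lines pass through one point. -/
theorem exists_common_point [Fintype ι] {U : (ι → ℂ) → ι → ℂ}
    (hU : ∀ μ ν a b c, minor₃ (U μ) (U ν) (ν - μ) a b c = 0) {p q r : ι → ℂ}
    (hpqr : LinearIndependent ℂ ![U p, U q, U r]) :
    ∃ O : ι → ℂ, ∀ μ b c, U μ b * (μ c - O c) = U μ c * (μ b - O b) := by
  have hpq : LinearIndependent ℂ ![U p, U q] := by
    have := hpqr.comp ![0, 1] (by decide)
    convert this using 1
    ext i j; fin_cases i <;> rfl
  have hpr : LinearIndependent ℂ ![U p, U r] := by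
    have := hpqr.comp ![0, 2] (by decide)
    convert this using 1
    ext i j; fin_cases i <;> rfl
  have hqr : LinearIndependent ℂ ![U q, U r] := by
    have := hpqr.comp ![1, 2] (by decide)
    convert this using 1
    ext i j; fin_cases i <;> rfl
  obtain ⟨α, β, h1⟩ := exists_eq_of_minor₃_eq_zero hpq (hU p q)
  obtain ⟨γ, δ, h2⟩ := exists_eq_of_minor₃_eq_zero hpr (hU p r)
  obtain ⟨ε, η, h3⟩ := exists_eq_of_minor₃_eq_zero hqr (hU q r)
  -- The triangle `p`, `q`, `r` closes up; independence of the directions then forces the three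
  -- pairwise intersection points to agree, at `p + α • U p`.
  have h0 : (α - γ) • U p + (β + ε) • U q + (η - δ) • U r = 0 := by
    have : (q - p) + (r - q) - (r - p) = 0 := by abel
    rw [h1, h2, h3] at this
    rw [← this]
    module
  have hli := Fintype.linearIndependent_iff.1 hpqr ![α - γ, β + ε, η - δ]
    (by simpa [Fin.sum_univ_three, add_assoc] using h0)
  have hα : α = γ := by simpa [sub_eq_zero] using hli 0
  have hβ : β = -ε := by simpa [add_eq_zero_iff_eq_neg] using hli 1
  have hη : η = δ := by simpa [sub_eq_zero] using hli 2
  have hq : ∀ i, q i - (p + α • U p) i = β * U q i := by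
    intro i
    have := congrFun h1 i
    simp only [Pi.add_apply, Pi.sub_apply, Pi.smul_apply, smul_eq_mul] at this ⊢
    linear_combination this
  have hr : ∀ i, r i - (p + α • U p) i = δ * U r i := by
    intro i
    have := congrFun h2 i
    rw [← hα] at this
    simp only [Pi.add_apply, Pi.sub_apply, Pi.smul_apply, smul_eq_mul] at this ⊢
    linear_combination this
  have hp : ∀ i, p i - (p + α • U p) i = (-α) * U p i := by
    intro i
    simp only [Pi.add_apply, Pi.smul_apply, smul_eq_mul]
    ring
  generalize p + α • U p = O at hp hq hr
  refine ⟨O, fun μ b c => ?_⟩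
  by_contra hne
  have hli : LinearIndependent ℂ ![U μ, μ - O] :=
    linearIndependent_pair_of_minor_ne_zero (b := b) (c := c)
      (by simpa [sub_eq_zero] using hne)
  -- If the line through `μ` missed `O`, every line through `O` coplanar with it would lie in the
  -- plane spanned by `U μ` and `μ - O`; three independent directions do not fit there.
  have key : ∀ {x : ι → ℂ} {κ : ℂ}, (∀ i, x i - O i = κ * U x i) →
      U x ∈ Submodule.span ℂ {U μ, μ - O} := by
    intro x κ hx
    obtain ⟨s, t, hst⟩ := exists_eq_of_minor₃_eq_zero hli (z := U x) (by
      intro a b c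
      have h4 := hU μ x a b c
      have ha := hx a
      have hb := hx b
      have hc := hx c
      simp only [minor₃, Pi.sub_apply] at h4 ⊢
      rw [sub_eq_iff_eq_add] at ha hb hc
      rw [ha, hb, hc] at h4
      linear_combination h4)
    exact Submodule.mem_span_pair.2 ⟨s, t, hst.symm⟩
  exact not_linearIndependent_of_mem_span_pair (key hp) (key hq) (key hr) hpqr

/-- A family spanning a space of dimension at least three contains three independent vectors. -/
theorem exists_three_linearIndependent {V T : Type*} [AddCommGroup V] [Module ℂ V]
    [FiniteDimensional ℂ V] (hV : 3 ≤ Module.finrank ℂ V) {U : T → V}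
    (hU : Submodule.span ℂ (Set.range U) = ⊤) :
    ∃ p q r, LinearIndependent ℂ ![U p, U q, U r] := by
  have hstep : ∀ {k : ℕ} (v : Fin k → V), k < 3 → ∃ p, U p ∉ Submodule.span ℂ (Set.range v) := by
    intro k v hk
    by_contra! hn
    have h1 : Submodule.span ℂ (Set.range U) ≤ Submodule.span ℂ (Set.range v) :=
      Submodule.span_le.2 (Set.range_subset_iff.2 hn)
    have h2 := Submodule.finrank_mono h1
    rw [hU, finrank_top] at h2
    have h3 := finrank_range_le_card (R := ℂ) v
    rw [Set.finrank, Fintype.card_fin] at h3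
    omega
  obtain ⟨r, hr⟩ := hstep ![] (by norm_num)
  have h1 : LinearIndependent ℂ ![U r] := linearIndependent_finCons.2
    ⟨linearIndependent_empty_type, hr⟩
  obtain ⟨q, hq⟩ := hstep ![U r] (by norm_num)
  have h2 : LinearIndependent ℂ ![U q, U r] := linearIndependent_finCons.2 ⟨h1, hq⟩
  obtain ⟨p, hp⟩ := hstep ![U q, U r] (by norm_num)
  exact ⟨p, q, r, linearIndependent_finCons.2 ⟨h2, hp⟩⟩

end LinearAlgebra

/-! ### The functional equation for the gradients. -/

section FunctionalEquation

variable {d : ℕ}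

local notation "𝔼" d => EuclideanSpace ℝ (Fin d)

/-- The test function on `𝕊 × 𝕊` which detects dependence on the sum of the variables. -/
noncomputable def minorTest (μ ν : Fin d → ℂ) (a b c : Fin d) (p : USphere d × USphere d) : ℂ :=
  Complex.exp (cdot μ (p.1 : 𝔼 d)) * Complex.exp (cdot ν (p.2 : 𝔼 d)) *
    minor₃ (fun i => (((p.1 : 𝔼 d) i : ℝ) : ℂ)) (fun i => (((p.2 : 𝔼 d) i : ℝ) : ℂ)) (ν - μ) a b c

theorem continuous_minorTest (μ ν : Fin d → ℂ) (a b c : Fin d) :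
    Continuous (minorTest μ ν a b c) := by
  unfold minorTest minor₃
  fun_prop

theorem integral_mul_minorTest {f₁ f₂ : USphere d → ℂ} (hf₁ : Integrable f₁ (surfaceMeasure d))
    (hf₂ : Integrable f₂ (surfaceMeasure d)) (μ ν : Fin d → ℂ) (a b c : Fin d) :
    ∫ p, f₁ p.1 * f₂ p.2 * minorTest μ ν a b c p ∂((surfaceMeasure d).prod (surfaceMeasure d)) =
      minor₃ (laplaceGrad f₁ μ) (laplaceGrad f₂ ν) (ν - μ) a b c := by
  let A : Fin d → USphere d → ℂ := fun i ζ =>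
    f₁ ζ * ((((ζ : 𝔼 d) i : ℝ) : ℂ) * Complex.exp (cdot μ (ζ : 𝔼 d)))
  let B : Fin d → USphere d → ℂ := fun i ζ =>
    f₂ ζ * ((((ζ : 𝔼 d) i : ℝ) : ℂ) * Complex.exp (cdot ν (ζ : 𝔼 d)))
  have hA : ∀ i, Integrable (A i) (surfaceMeasure d) := fun i =>
    integrable_mul_continuous hf₁ (by fun_prop)
  have hB : ∀ i, Integrable (B i) (surfaceMeasure d) := fun i =>
    integrable_mul_continuous hf₂ (by fun_prop)
  let T : Fin d → Fin d → USphere d × USphere d → ℂ := fun i j p => A i p.1 * B j p.2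
  have hTi : ∀ i j, Integrable (T i j) ((surfaceMeasure d).prod (surfaceMeasure d)) := fun i j =>
    (hA i).mul_prod (hB j)
  have hT : ∀ i j, ∫ p, T i j p ∂((surfaceMeasure d).prod (surfaceMeasure d)) =
      laplaceGrad f₁ μ i * laplaceGrad f₂ ν j := fun i j => integral_prod_mul (A i) (B j)
  have hexp : ∀ p, f₁ p.1 * f₂ p.2 * minorTest μ ν a b c p =
      (ν - μ) c * (T a b p - T b a p) + (ν - μ) b * (T c a p - T a c p) +
        (ν - μ) a * (T b c p - T c b p) := by
    intro p
    simp only [minorTest, minor₃, T, A, B]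
    ring
  simp only [hexp, minor₃, ← hT]
  rw [integral_add, integral_add, integral_const_mul, integral_const_mul, integral_const_mul,
    integral_sub, integral_sub, integral_sub]
  all_goals
    first
    | exact hTi _ _
    | exact ((hTi _ _).sub (hTi _ _)).const_mul _
    | exact (((hTi _ _).sub (hTi _ _)).const_mul _).add (((hTi _ _).sub (hTi _ _)).const_mul _)

/-- For `f₁ = f₂ = 1` the gradients are parallel to `μ` and `ν`, hence dependent with `ν - μ`. -/
theorem integral_minorTest_eq_zero (μ ν : Fin d → ℂ) (a b c : Fin d) :
    ∫ p, minorTest μ ν a b c p ∂((surfaceMeasure d).prod (surfaceMeasure d)) = 0 := by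
  have h := integral_mul_minorTest (d := d) (f₁ := 1) (f₂ := 1) (integrable_const (1 : ℂ))
    (integrable_const (1 : ℂ)) μ ν a b c
  simp only [Pi.one_apply, one_mul] at h
  rw [h]
  have hμ := laplaceGrad_one_radial μ
  have hν := laplaceGrad_one_radial ν
  simp only [minor₃, Pi.sub_apply]
  generalize laplaceGrad 1 μ = x at *
  generalize laplaceGrad 1 ν = y at *
  linear_combination x a * hν b c - x b * hν a c + x c * hν a b
    - (y a * hμ c b - y b * hμ c a + y c * hμ b a)

theorem minor₃_laplaceGrad_eq_zero {f₁ f₂ : USphere d → ℂ}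
    (hf₁ : Integrable f₁ (surfaceMeasure d)) (hf₂ : Integrable f₂ (surfaceMeasure d))
    (hP : AEStronglyMeasurable[MeasurableSpace.comap (sphereAdd d) inferInstance]
      (fun p => f₁ p.1 * f₂ p.2) ((surfaceMeasure d).prod (surfaceMeasure d)))
    (μ ν : Fin d → ℂ) (a b c : Fin d) :
    minor₃ (laplaceGrad f₁ μ) (laplaceGrad f₂ ν) (ν - μ) a b c = 0 := by
  have hcont := continuous_minorTest μ ν a b c
  obtain ⟨C, hC⟩ := isCompact_univ.exists_bound_of_continuousOn hcont.continuousOn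
  have hInt : Integrable (minorTest μ ν a b c) ((surfaceMeasure d).prod (surfaceMeasure d)) :=
    Integrable.of_bound hcont.aestronglyMeasurable C (ae_of_all _ fun p => hC p (Set.mem_univ _))
  rw [← integral_mul_minorTest hf₁ hf₂]
  refine integral_mul_eq_zero_of_charFun (measurable_sphereAdd d) hInt hP
    ((integrable_tensor hf₁ hf₂).mul_bdd hcont.aestronglyMeasurable
      (ae_of_all _ fun p => hC p (Set.mem_univ _))) fun ξ => ?_
  -- Multiplying by a character of the sum shifts both frequencies by `i ξ` and leaves `ν - μ`
  -- unchanged, so the test function is orthogonal to all functions of the sum.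
  rw [← integral_minorTest_eq_zero (μ + imFreq ξ) (ν + imFreq ξ) a b c]
  refine integral_congr_ae (ae_of_all _ fun p => ?_)
  simp only [minorTest, cdot_add_left, Complex.exp_add, cdot_imFreq, sphereAdd, inner_add_left,
    Complex.ofReal_add, add_mul, add_sub_add_right_eq_sub]
  ring

/-- If `f₁ ⊗ f₂` is a function of the sum of the variables, then `f₂` is proportional to `f₁`. -/
theorem exists_ae_eq_const_mul {f₁ f₂ : USphere d → ℂ}
    (hP : AEStronglyMeasurable[MeasurableSpace.comap (sphereAdd d) inferInstance]
      (fun p => f₁ p.1 * f₂ p.2) ((surfaceMeasure d).prod (surfaceMeasure d)))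
    (hf₁0 : ¬ f₁ =ᵐ[surfaceMeasure d] 0) :
    ∃ κ : ℂ, ∀ᵐ ζ ∂(surfaceMeasure d), f₂ ζ = κ * f₁ ζ := by
  obtain ⟨K, hK, hPK⟩ := hP
  obtain ⟨F, -, rfl⟩ := hK.exists_eq_measurable_comp
  have hswap := (Measure.measurePreserving_swap (μ := surfaceMeasure d)
    (ν := surfaceMeasure d)).quasiMeasurePreserving.ae hPK
  have hsym : ∀ᵐ p ∂((surfaceMeasure d).prod (surfaceMeasure d)),
      f₁ p.1 * f₂ p.2 = f₁ p.2 * f₂ p.1 := by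
    filter_upwards [hPK, hswap] with p h1 h2
    rw [h1]
    simp only [Prod.fst_swap, Prod.snd_swap] at h2
    rw [h2]
    simp [sphereAdd, add_comm]
  have h1 := Measure.ae_ae_of_ae_prod hsym
  -- One good point `ζ` with `f₁ ζ ≠ 0` is fixed; the symmetric identity then determines `f₂` from
  -- `f₁`.
  obtain ⟨ζ, hζ, h2⟩ := ((Filter.not_eventually.1 hf₁0).and_eventually h1).exists
  simp only [Pi.zero_apply] at hζ
  refine ⟨f₂ ζ / f₁ ζ, ?_⟩
  filter_upwards [h2] with η hη
  field_simp
  linear_combination hη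

-- The cone over this set lies in the hyperplane orthogonal to `a`, which is Lebesgue null.
open Pointwise in
theorem surfaceMeasure_hyperplane {a : 𝔼 d} (ha : a ≠ 0) :
    surfaceMeasure d {ζ | inner ℝ a (ζ : 𝔼 d) = 0} = 0 := by
  have hmeas : MeasurableSet {ζ : USphere d | inner ℝ a (ζ : 𝔼 d) = 0} :=
    (by fun_prop : Continuous fun ζ : USphere d => inner ℝ a (ζ : 𝔼 d)).measurable
      (measurableSet_singleton 0)
  rw [surfaceMeasure, Measure.toSphere_apply' _ hmeas]
  refine mul_eq_zero_of_right _ (measure_mono_null ?_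
    (Measure.addHaar_submodule volume (ℝ ∙ a)ᗮ ?_))
  · rintro _ ⟨r, -, _, ⟨ζ, hζ, rfl⟩, rfl⟩
    simp only [Set.mem_ofPred_eq] at hζ
    simp [Submodule.mem_orthogonal_singleton_iff_inner_right, inner_smul_right, hζ]
  · intro h
    rw [Submodule.orthogonal_eq_top_iff, Submodule.span_singleton_eq_bot] at h
    exact ha h

/-- A nonzero complex linear form vanishes only on a null subset of the sphere. -/
theorem eq_zero_of_mul_cdot_ae_eq_zero {f : USphere d → ℂ} (hf0 : ¬ f =ᵐ[surfaceMeasure d] 0)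
    {w : Fin d → ℂ} (h : ∀ᵐ ζ : USphere d ∂(surfaceMeasure d), f ζ * cdot w (ζ : 𝔼 d) = 0) :
    w = 0 := by
  have key : ∀ a : 𝔼 d, (∀ ζ : USphere d, cdot w (ζ : 𝔼 d) = 0 → inner ℝ a (ζ : 𝔼 d) = 0) →
      a = 0 := by
    intro a ha
    by_contra ha0
    refine hf0 ?_
    have h1 : ∀ᵐ ζ : USphere d ∂(surfaceMeasure d), ¬ inner ℝ a (ζ : 𝔼 d) = 0 := by
      rw [ae_iff]
      simpa using surfaceMeasure_hyperplane ha0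
    filter_upwards [h, h1] with ζ h2 h3
    exact (mul_eq_zero.1 h2).resolve_right fun h4 => h3 (ha ζ h4)
  have hre := key (WithLp.toLp 2 fun i => (w i).re) fun ζ hζ => by
    have := congrArg Complex.re hζ
    simpa [cdot, PiLp.inner_apply, mul_comm] using this
  have him := key (WithLp.toLp 2 fun i => (w i).im) fun ζ hζ => by
    have := congrArg Complex.im hζ
    simpa [cdot, PiLp.inner_apply, mul_comm] using this
  funext i
  refine Complex.ext ?_ ?_
  · simpa using congrArg (fun x : 𝔼 d => x i) hre
  · simpa using congrArg (fun x : 𝔼 d => x i) him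

/-- A linear form `w` killing all gradients would, at the frequencies `i ξ`, make the Fourier
transform of `f(ζ) (w·ζ) σ` vanish; then `f(ζ) (w·ζ) = 0` a.e., which forces `w = 0`. -/
theorem span_range_laplaceGrad {f : USphere d → ℂ} (hf : Integrable f (surfaceMeasure d))
    (hf0 : ¬ f =ᵐ[surfaceMeasure d] 0) :
    Submodule.span ℂ (Set.range (laplaceGrad f)) = ⊤ := by
  by_contra hne
  obtain ⟨φ, hφ0, hφ⟩ := Submodule.exists_le_ker_of_lt_top _ (lt_top_iff_ne_top.2 hne)
  let w : Fin d → ℂ := fun i => φ fun j => if i = j then 1 else 0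
  have hφw : ∀ x, φ x = ∑ i, x i * w i := by
    intro x
    simpa using (LinearMap.pi_apply_eq_sum_univ φ x)
  have h1 : ∀ μ, ∑ i, laplaceGrad f μ i * w i = 0 := by
    intro μ
    rw [← hφw]
    exact hφ (Submodule.subset_span ⟨μ, rfl⟩)
  have h2 : ∀ ξ : 𝔼 d, ∫ ζ : USphere d, Complex.exp ((inner ℝ (ζ : 𝔼 d) ξ : ℝ) * Complex.I) *
      (f ζ * cdot w (ζ : 𝔼 d)) ∂(surfaceMeasure d) = 0 := by
    intro ξ
    rw [← h1 (imFreq ξ)]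
    simp only [laplaceGrad, ← integral_mul_const]
    rw [← integral_finsetSum _ fun i _ =>
        (integrable_mul_continuous hf (by fun_prop)).mul_const _]
    refine integral_congr_ae (ae_of_all _ fun ζ => ?_)
    simp only [cdot_imFreq]
    simp only [cdot, Finset.mul_sum]
    exact Finset.sum_congr rfl fun i _ => by ring
  have h3 := ae_eq_zero_of_charFun (MeasurableEmbedding.subtype_coe
    (Metric.isClosed_sphere (x := (0 : 𝔼 d)) (ε := 1)).measurableSet)
    (integrable_mul_continuous hf (by fun_prop)) h2
  have hw := eq_zero_of_mul_cdot_ae_eq_zero hf0 h3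
  refine hφ0 (LinearMap.ext fun x => ?_)
  simp [hφw, hw]

theorem exists_center {f : USphere d → ℂ} (hd : 3 ≤ d) (hf : Integrable f (surfaceMeasure d))
    (hf0 : ¬ f =ᵐ[surfaceMeasure d] 0)
    (h : ∀ μ ν a b c, minor₃ (laplaceGrad f μ) (laplaceGrad f ν) (ν - μ) a b c = 0) :
    ∃ O : Fin d → ℂ, ∀ μ b c,
      laplaceGrad f μ b * (μ c - O c) = laplaceGrad f μ c * (μ b - O b) := by
  obtain ⟨p, q, r, hpqr⟩ := exists_three_linearIndependent (by simpa using hd)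
    (span_range_laplaceGrad hf hf0)
  exact exists_common_point h hpqr

end FunctionalEquation

/-! ### From radial gradients to exponentials. -/

section Rigidity

variable {d : ℕ}

local notation "𝔼" d => EuclideanSpace ℝ (Fin d)

/-- A differentiable function on `ℝ^d`, `d ≥ 2`, whose derivative vanishes on tangential
directions is radial. -/
theorem eq_of_norm_eq_of_fderiv_tangential (hd : 2 ≤ d) {Γ : (𝔼 d) → ℂ}
    (hΓ : Differentiable ℝ Γ) (h : ∀ x v : 𝔼 d, x ≠ 0 → inner ℝ x v = 0 → fderiv ℝ Γ x v = 0)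
    {x y : 𝔼 d} (hxy : ‖x‖ = ‖y‖) : Γ x = Γ y := by
  rcases eq_or_ne x 0 with rfl | hx
  · rw [norm_zero, eq_comm, norm_eq_zero] at hxy
    rw [hxy]
  have hy : y ≠ 0 := by
    rintro rfl
    simp [hx] at hxy
  -- `N` retracts onto the sphere of radius `‖x‖`. Its derivative is tangential because `‖N z‖` is
  -- constant, so `Γ ∘ N` is constant on the punctured space, which is connected as `d ≥ 2`.
  let N : (𝔼 d) → 𝔼 d := fun z => (‖x‖ * ‖z‖⁻¹) • z
  have hN : ∀ z : 𝔼 d, z ≠ 0 → DifferentiableAt ℝ N z := by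
    intro z hz
    have h1 : DifferentiableAt ℝ (fun z : 𝔼 d => ‖z‖) z := (contDiffAt_norm ℝ hz).differentiableAt
      (n := 1) one_ne_zero
    exact ((h1.inv (norm_ne_zero_iff.2 hz)).const_mul ‖x‖).smul differentiableAt_id
  have hNn : ∀ z : 𝔼 d, z ≠ 0 → inner ℝ (N z) (N z) = ‖x‖ ^ 2 := by
    intro z hz
    rw [real_inner_self_eq_norm_sq, norm_smul, norm_mul, norm_inv, norm_norm, norm_norm,
      inv_mul_cancel_right₀ (norm_ne_zero_iff.2 hz)]
  have hopen : IsOpen ({0}ᶜ : Set (𝔼 d)) := isOpen_compl_singleton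
  have hrank : 1 < Module.rank ℝ (𝔼 d) := by
    rw [← Module.finrank_eq_rank, finrank_euclideanSpace, Fintype.card_fin]
    exact_mod_cast hd
  have hconst := hopen.is_const_of_fderiv_eq_zero (𝕜 := ℝ) (f := Γ ∘ N)
    (isConnected_compl_singleton_of_one_lt_rank hrank 0).isPreconnected
    (fun z hz => ((hΓ (N z)).comp z (hN z hz)).differentiableWithinAt)
    (fun z hz => ?_) (x := x) (y := y) hx hy
  · have e1 : N x = x := by simp [N, hx]
    have e2 : N y = y := by simp [N, hxy, hy]
    simpa [e1, e2] using hconst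
  · have hz : z ≠ 0 := hz
    rw [fderiv_comp z (hΓ (N z)) (hN z hz)]
    ext v
    have hNz : N z ≠ 0 := by
      intro h0
      have := hNn z hz
      rw [h0, inner_zero_left, eq_comm, sq_eq_zero_iff, norm_eq_zero] at this
      exact hx this
    refine h _ _ hNz ?_
    have h2 : HasFDerivAt (fun z => inner ℝ (N z) (N z)) _ z :=
      (hN z hz).hasFDerivAt.inner ℝ (hN z hz).hasFDerivAt
    have h3 := h2.unique ((hasFDerivAt_const (‖x‖ ^ 2) z).congr_of_eventuallyEq
      (Filter.eventually_of_mem (hopen.mem_nhds hz) fun w hw => hNn w hw))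
    have h4 := congrArg (fun L => L v) h3
    simpa [fderivInnerCLM_apply, real_inner_comm] using h4

/-- `imFreq` as a continuous linear map. -/
noncomputable def imFreqCLM : (𝔼 d) →L[ℝ] (Fin d → ℂ) :=
  LinearMap.toContinuousLinearMap
    { toFun := imFreq
      map_add' := fun x y => by ext j; simp [imFreq, mul_add]
      map_smul' := fun r x => by ext j; simp [imFreq]; ring }

theorem imFreqCLM_apply (ξ : 𝔼 d) : imFreqCLM ξ = imFreq ξ := rfl

theorem hasFDerivAt_laplace_imFreq {g : USphere d → ℂ} (hg : Integrable g (surfaceMeasure d))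
    (ξ : 𝔼 d) : HasFDerivAt (fun ξ => laplace g (imFreq ξ))
      (((coeffForm (laplaceGrad g (imFreq ξ))).restrictScalars ℝ).comp imFreqCLM) ξ :=
  ((hasFDerivAt_laplace hg (imFreqCLM ξ)).restrictScalars ℝ).comp ξ imFreqCLM.hasFDerivAt

/-- A function on the sphere whose Fourier transform has a radial gradient is constant. -/
theorem ae_eq_const_of_laplaceGrad_radial (hd : 2 ≤ d) {g : USphere d → ℂ}
    (hg : Integrable g (surfaceMeasure d))
    (h : ∀ μ b c, laplaceGrad g μ b * μ c = laplaceGrad g μ c * μ b) :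
    ∃ C : ℂ, ∀ᵐ ζ ∂(surfaceMeasure d), g ζ = C := by
  have : NeZero d := ⟨by omega⟩
  have hrad : ∀ {x y : 𝔼 d}, ‖x‖ = ‖y‖ → laplace g (imFreq x) = laplace g (imFreq y) := by
    intro x y hxy
    refine eq_of_norm_eq_of_fderiv_tangential hd (Γ := fun ξ => laplace g (imFreq ξ))
      (fun ξ => (hasFDerivAt_laplace_imFreq hg ξ).differentiableAt) (fun ξ v hξ hξv => ?_) hxy
    rw [(hasFDerivAt_laplace_imFreq hg ξ).fderiv]
    simp only [ContinuousLinearMap.comp_apply, ContinuousLinearMap.coe_restrictScalars',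
      imFreqCLM_apply, coeffForm_apply]
    obtain ⟨c, hc⟩ : ∃ c, ξ c ≠ 0 := by
      by_contra! hn
      exact hξ (by ext i; simpa using hn i)
    have hc' : imFreq ξ c ≠ 0 := by simpa [imFreq] using hc
    refine (mul_eq_zero.1 (?_ : _ * imFreq ξ c = 0)).resolve_right hc'
    have h1 : ∑ i, ((ξ i : ℝ) : ℂ) * ((v i : ℝ) : ℂ) = 0 := by
      have := congrArg (fun r : ℝ => (r : ℂ)) hξv
      simpa [PiLp.inner_apply, mul_comm] using this
    calc (∑ i, laplaceGrad g (imFreq ξ) i * imFreq v i) * imFreq ξ c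
        = -laplaceGrad g (imFreq ξ) c * ∑ i, ((ξ i : ℝ) : ℂ) * ((v i : ℝ) : ℂ) := by
          rw [Finset.sum_mul, Finset.mul_sum]
          refine Finset.sum_congr rfl fun i _ => ?_
          have h2 := h (imFreq ξ) i c
          simp only [imFreq] at h2 ⊢
          linear_combination (Complex.I * (v i : ℂ)) * h2 +
            (laplaceGrad g (imFreq ξ) c * ξ i * v i) * Complex.I_mul_I
      _ = 0 := by rw [h1, mul_zero]
  have hσ : (surfaceMeasure d).real Set.univ ≠ 0 := by
    rw [measureReal_def]
    exact (ENNReal.toReal_pos (by simpa using surfaceMeasure_ne_zero) (measure_ne_top _ _)).ne'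
  have hlap : ∀ (f : USphere d → ℂ) (ξ : 𝔼 d), laplace f (imFreq ξ) =
      ∫ ζ : USphere d, f ζ * Complex.exp ((inner ℝ (ζ : 𝔼 d) ξ : ℝ) * Complex.I)
        ∂(surfaceMeasure d) := by
    intro f ξ
    simp only [laplace, cdot_imFreq]
  -- Averaging a radial transform over the sphere of radius `‖ξ‖` and exchanging the integrals
  -- replaces each character by the transform of `σ`: `g` has the same transform as its mean value.
  have hprop : ∀ ξ : 𝔼 d, ((surfaceMeasure d).real Set.univ : ℂ) * laplace g (imFreq ξ) =
      (∫ ζ, g ζ ∂(surfaceMeasure d)) * laplace 1 (imFreq ξ) := by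
    intro ξ
    have hInt : Integrable (fun p : USphere d × USphere d => g p.2 *
        Complex.exp ((inner ℝ (p.2 : 𝔼 d) (‖ξ‖ • (p.1 : 𝔼 d)) : ℝ) * Complex.I))
        ((surfaceMeasure d).prod (surfaceMeasure d)) := by
      have h1 := (integrable_const (1 : ℂ) (μ := surfaceMeasure d)).mul_prod hg
      simp only [one_mul] at h1
      refine h1.mul_bdd (c := 1) (by fun_prop) ?_
      exact ae_of_all _ fun p => (Complex.norm_exp_ofReal_mul_I _).le
    calc ((surfaceMeasure d).real Set.univ : ℂ) * laplace g (imFreq ξ)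
        = ∫ ω : USphere d, laplace g (imFreq (‖ξ‖ • (ω : 𝔼 d))) ∂(surfaceMeasure d) := by
          rw [← Complex.real_smul, ← integral_const]
          refine integral_congr_ae (ae_of_all _ fun ω => hrad ?_)
          simp [norm_smul]
      _ = ∫ ω : USphere d, ∫ ζ : USphere d, g ζ *
            Complex.exp ((inner ℝ (ζ : 𝔼 d) (‖ξ‖ • (ω : 𝔼 d)) : ℝ) * Complex.I)
            ∂(surfaceMeasure d) ∂(surfaceMeasure d) := by simp only [hlap]
      _ = ∫ ζ : USphere d, ∫ ω : USphere d, g ζ *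
            Complex.exp ((inner ℝ (ζ : 𝔼 d) (‖ξ‖ • (ω : 𝔼 d)) : ℝ) * Complex.I)
            ∂(surfaceMeasure d) ∂(surfaceMeasure d) := integral_integral_swap hInt
      _ = ∫ ζ : USphere d, g ζ * laplace 1 (imFreq ξ) ∂(surfaceMeasure d) := by
          refine integral_congr_ae (ae_of_all _ fun ζ => ?_)
          simp only [integral_const_mul, hlap, Pi.one_apply, one_mul]
          congr 1
          have := integral_exp_inner_eq 1 (x := ‖ξ‖ • (ζ : 𝔼 d)) (y := ξ) (by simp [norm_smul])
          simp only [one_smul] at this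
          simp only [real_inner_comm _ ξ, inner_smul_right] at this ⊢
          rw [← this]
          simp only [inner_smul_left, conj_trivial]
      _ = _ := integral_mul_const _ _
  refine ⟨(∫ ζ, g ζ ∂(surfaceMeasure d)) / ((surfaceMeasure d).real Set.univ : ℂ), ?_⟩
  set C := (∫ ζ, g ζ ∂(surfaceMeasure d)) / ((surfaceMeasure d).real Set.univ : ℂ) with hC
  have h0 := ae_eq_zero_of_charFun (G := fun ζ => g ζ - C) (W := surfaceMeasure d)
    (MeasurableEmbedding.subtype_coe
    (Metric.isClosed_sphere (x := (0 : 𝔼 d)) (ε := 1)).measurableSet)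
    (hg.sub (integrable_const C)) (fun ξ => ?_)
  · filter_upwards [h0] with ζ hζ
    simpa [sub_eq_zero] using hζ
  · have h1 := integral_sub
      (integrable_mul_continuous hg (g := fun ζ : USphere d =>
        Complex.exp ((inner ℝ (ζ : 𝔼 d) ξ : ℝ) * Complex.I)) (by fun_prop))
      (integrable_mul_continuous (integrable_const C) (g := fun ζ : USphere d =>
        Complex.exp ((inner ℝ (ζ : 𝔼 d) ξ : ℝ) * Complex.I)) (by fun_prop))
    have h2 : ∫ ζ : USphere d, C * Complex.exp ((inner ℝ (ζ : 𝔼 d) ξ : ℝ) * Complex.I)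
        ∂(surfaceMeasure d) = C * laplace 1 (imFreq ξ) := by
      rw [integral_const_mul, hlap]
      simp
    rw [← hlap, h2] at h1
    have h3 : laplace g (imFreq ξ) = C * laplace 1 (imFreq ξ) := by
      have hσ' : ((surfaceMeasure d).real Set.univ : ℂ) ≠ 0 := by exact_mod_cast hσ
      rw [hC, div_mul_eq_mul_div, eq_div_iff hσ', ← hprop]
      ring
    rw [h3, sub_self] at h1
    rw [← h1]
    refine integral_congr_ae (ae_of_all _ fun ζ => ?_)
    simp only
    ring

/-- If the gradient of the Fourier–Laplace transform of `f` is radial with respect to some center,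
then `f` is an exponential. -/
theorem ae_eq_exp_of_center (hd : 2 ≤ d) {f : USphere d → ℂ}
    (hf : Integrable f (surfaceMeasure d)) {O : Fin d → ℂ}
    (h : ∀ μ b c, laplaceGrad f μ b * (μ c - O c) = laplaceGrad f μ c * (μ b - O b)) :
    ∃ C : ℂ, ∀ᵐ ζ : USphere d ∂(surfaceMeasure d),
      f ζ = C * Complex.exp (cdot (-O) (ζ : 𝔼 d)) := by
  have hgrad : ∀ μ i, laplaceGrad (fun ζ : USphere d => f ζ * Complex.exp (cdot O (ζ : 𝔼 d))) μ i =
      laplaceGrad f (μ + O) i := by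
    intro μ i
    refine integral_congr_ae (ae_of_all _ fun ζ => ?_)
    simp only [cdot_add_left, Complex.exp_add]
    ring
  obtain ⟨C, hC⟩ := ae_eq_const_of_laplaceGrad_radial hd
    (g := fun ζ : USphere d => f ζ * Complex.exp (cdot O (ζ : 𝔼 d)))
    (integrable_mul_continuous hf (by fun_prop)) (fun μ b c => by
      rw [hgrad, hgrad]
      simpa using h (μ + O) b c)
  refine ⟨C, ?_⟩
  filter_upwards [hC] with ζ hζ
  have h0 : cdot (-O) (ζ : 𝔼 d) = -cdot O (ζ : 𝔼 d) := by simp [cdot]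
  rw [← hζ, h0, mul_assoc, ← Complex.exp_add, add_neg_cancel, Complex.exp_zero, mul_one]

end Rigidity

/-! ### The inequality and its equality case. -/

theorem corollary3 (d : ℕ) (hd : 2 ≤ d) (f₁ f₂ : USphere d → ℂ)
    (hf₁ : Integrable f₁ (surfaceMeasure d)) (hf₂ : Integrable f₂ (surfaceMeasure d))
    (hf₁0 : ¬ f₁ =ᵐ[surfaceMeasure d] 0) (hf₂0 : ¬ f₂ =ᵐ[surfaceMeasure d] 0) :
    bilinearExtensionNormSq d f₁ f₂ ≤ weightedSide d f₁ f₂ ∧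
    (3 ≤ d → weightedSide d f₁ f₂ < ∞ →
      (bilinearExtensionNormSq d f₁ f₂ = weightedSide d f₁ f₂ ↔
        ∃ (c₁ c₂ : ℂ) (ν : Fin d → ℂ), c₁ ≠ 0 ∧ c₂ ≠ 0 ∧
          (∀ᵐ ζ ∂(surfaceMeasure d), f₁ ζ =
            c₁ * Complex.exp (∑ i, ν i * (((ζ : EuclideanSpace ℝ (Fin d)) i : ℝ) : ℂ))) ∧
          (∀ᵐ ζ ∂(surfaceMeasure d), f₂ ζ =
            c₂ * Complex.exp (∑ i, ν i * (((ζ : EuclideanSpace ℝ (Fin d)) i : ℝ) : ℂ))))) := by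
  obtain ⟨hle, hiff⟩ := bilinearExtensionNormSq_le hd hf₁ hf₂
  refine ⟨hle, fun hd3 hfin => (hiff hfin).trans ⟨fun hP => ?_, ?_⟩⟩
  · obtain ⟨κ, hκ⟩ := exists_ae_eq_const_mul hP hf₁0
    have hκ0 : κ ≠ 0 := by
      rintro rfl
      exact hf₂0 (hκ.mono fun ζ hζ => by simpa using hζ)
    have hgrad : ∀ μ i, laplaceGrad f₂ μ i = κ * laplaceGrad f₁ μ i := by
      intro μ i
      rw [laplaceGrad, laplaceGrad, ← integral_const_mul]
      refine integral_congr_ae ?_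
      filter_upwards [hκ] with ζ hζ
      rw [hζ, mul_assoc]
    obtain ⟨O, hO⟩ := exists_center hd3 hf₁ hf₁0 fun μ ν a b c => by
      have := minor₃_laplaceGrad_eq_zero hf₁ hf₂ hP μ ν a b c
      simp only [minor₃, hgrad] at this ⊢
      -- The minor is linear in its second argument, so the nonzero factor `κ` can be removed and
      -- only `f₁` remains.
      refine (mul_eq_zero.1 (?_ : κ * _ = 0)).resolve_left hκ0
      linear_combination this
    obtain ⟨C, hC⟩ := ae_eq_exp_of_center hd hf₁ hO
    refine ⟨C, κ * C, -O, ?_, ?_, hC, ?_⟩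
    · rintro rfl
      exact hf₁0 (hC.mono fun ζ hζ => by simpa using hζ)
    · refine mul_ne_zero hκ0 ?_
      rintro rfl
      exact hf₁0 (hC.mono fun ζ hζ => by simpa using hζ)
    · filter_upwards [hκ, hC] with ζ h1 h2
      rw [h1, h2, mul_assoc]
      rfl
  · rintro ⟨c₁, c₂, ν, -, -, h₁, h₂⟩
    -- A common `ν` makes the tensor product `c₁ c₂ e^{ν·(ζ₁ + ζ₂)}`, a function of the sum.
    have hmeas : StronglyMeasurable[MeasurableSpace.comap (sphereAdd d) inferInstance]
        fun p => c₁ * c₂ * Complex.exp (cdot ν (sphereAdd d p)) :=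
      ((by fun_prop : Continuous fun x : EuclideanSpace ℝ (Fin d) =>
        c₁ * c₂ * Complex.exp (cdot ν x)).measurable.comp
          (comap_measurable (sphereAdd d))).stronglyMeasurable
    refine ⟨_, hmeas, ?_⟩
    filter_upwards [Measure.quasiMeasurePreserving_fst.ae h₁,
      Measure.quasiMeasurePreserving_snd.ae h₂] with p h₁ h₂
    rw [h₁, h₂, sphereAdd, cdot_add_right, Complex.exp_add]
    simp only [cdot]
    ring
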